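/- Let $M$ be a smooth manifold of dimension $n\ge 3$. Use natural coordinates $(x,y)=(x^1,\dots,x^n,y^1,\dots,y^n)$ on $TM\setminus\mathbf 0$, write $\partial_i=\partial/\partial x^i$ and $T_{\cdot i}=\partial T/\partial y^i$, and sum over repeated indices. A (homogeneous) nonlinear connection $\mathrm N$ on $TM\setminus\mathbf 0$ consists of smooth functions $\mathrm N_i^k(x,y)$, positively $1$-homogeneous in $y$, one family for each chart, which under changes of charts satisfy $$\bar{\mathrm N}_i^k=\frac{\partial\bar x^k}{\partial x^c}\frac{\partial^2x^c}{\partial\bar x^i\partial\bar x^b}\,\bar y^b+\frac{\partial\bar x^k}{\partial x^c}\frac{\partial x^a}{\partial\bar x^i}\,\mathrm N_a^c .$$ It is symmetric if $\mathrm N_{i\cdot j}^k=\mathrm N_{j\cdot i}^k$. A pseudo-Finsler metric on $TM\setminus\mathbf 0$ is a smooth function $L:TM\setminus\mathbf 0\to\mathbb R$, positively $2$-homogeneous in $y$, whose fundamental tensor $g_{ij}=\frac12L_{\cdot i\cdot j}$ is non-degenerate everywhere; it is (positive definite) Riemannian if $g_{ij}$ does not depend on $y$ and is positive definite. For such an $L$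 put $y_a=g_{ab}y^b$ and $$(\mathrm G^L)^i=\tfrac14 g^{ia}(2\,\partial_cg_{ab}-\partial_ag_{bc})y^by^c,\qquad(\mathrm N^L)_i^k=(\mathrm G^L)^k_{\cdot i},$$ $$\mathrm C_i=\tfrac12g^{ab}g_{ab\cdot i},\qquad\mathrm{Lan}_i=\tfrac12g^{ab}\nabla^L_ig_{ab},$$ where $\nabla^L$ is the covariant derivative of the Berwald anisotropic connection of $L$: $$\nabla^L_kg_{ij}=\partial_kg_{ij}-(\mathrm N^L)^a_k\,g_{ij\cdot a}-(\mathrm N^L)^a_{k\cdot i}\,g_{aj}-(\mathrm N^L)^a_{k\cdot j}\,g_{ia}.$$ A nonlinear connection $\mathrm N$ solves the affine equation of $L$ if $\mathcal J=\mathrm N-\mathrm N^L$ satisfies, on all of $TM\setminus\mathbf 0$ and for all $i,j$, $$\Big\{2\,\mathrm{Lan}_b+(n+2)\frac{y_a}{L}\mathcal J_b^a-2\,\mathrm C_a\mathcal J_b^a-\big(\mathcal J^a_{b\cdot a}+\mathcal J^a_{a\cdot b}\big)\Big\}\big(\delta_i^by^j-y^b\delta_i^j\big)-\big(\mathcal J^j_{i\cdot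 a}-\mathcal J^j_{a\cdot i}\big)y^a=0 .$$ **Theorem.** If $L$ is positive definite Riemannian (and $n\ge3$), then $\mathrm N^L$ is a symmetric nonlinear connection on $TM\setminus\mathbf 0$ that solves the affine equation of $L$, and it is the only one. -/

import Mathlib

open scoped Manifold ContDiff Matrix

noncomputable section

namespace FinslerPalatini

/-- The coordinate space of an `n`-dimensional manifold. -/
abbrev Coord (n : ℕ) := EuclideanSpace ℝ (Fin n)

/-- The smooth charts `(U, x)` of `M`, i.e. the elements of the maximal smooth atlas. -/
abbrev SmoothChart (n : ℕ) (M : Type*) [TopologicalSpace M] [ChartedSpace (Coord n) M] :=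
  {e : OpenPartialHomeomorph M (Coord n) // e ∈ IsManifold.maximalAtlas (𝓡 n) ∞ M}

/-- Partial derivative `∂_i f = ∂f/∂x^i` of a function of the natural coordinates `(x, y)`. -/
def dx {n : ℕ} (i : Fin n) (f : Coord n → Coord n → ℝ) (x y : Coord n) : ℝ :=
  fderiv ℝ (fun x' => f x' y) x (EuclideanSpace.single i 1)

/-- Vertical derivative `f_{·i} = ∂f/∂y^i` of a function of the natural coordinates `(x, y)`. -/
def dy {n : ℕ} (i : Fin n) (f : Coord n → Coord n → ℝ) (x y : Coord n) : ℝ :=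
  fderiv ℝ (fun y' => f x y') y (EuclideanSpace.single i 1)

section Manifold

variable {n : ℕ} {M : Type*} [TopologicalSpace M] [ChartedSpace (Coord n) M]

/-- The tangent vector `y^a ∂_a` at the point of coordinates `x`, in the chart `e`. -/
def tangentVec (e : SmoothChart n M) (x y : Coord n) : TangentBundle (𝓡 n) M :=
  ⟨e.1.symm x, mfderiv (𝓡 n) (𝓡 n) e.1.symm x y⟩

/-- The domain `T U ∖ 0` of the natural coordinates `(x, y)` on the slit tangent bundle. -/
def slitDomain (e : SmoothChart n M) : Set (Coord n × Coord n) :=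
  e.1.target ×ˢ {0}ᶜ

/-! ### Nonlinear connections -/

/-- A candidate for a nonlinear connection on `TM ∖ 0`, given by coefficients in each smooth chart:
`N e x y i k` is `N_i^k(x, y)` in the chart `e`. -/
abbrev CoeffFamily (n : ℕ) (M : Type*) [TopologicalSpace M] [ChartedSpace (Coord n) M] :=
  SmoothChart n M → Coord n → Coord n → Fin n → Fin n → ℝ

/-- Change of coordinates `x ↦ x̄` from the chart `e` to the chart `e'`. -/
def transition (e e' : SmoothChart n M) (x : Coord n) : Coord n := e'.1 (e.1.symm x)

/-- First partial derivative `∂x̄^k/∂x^i` of the change of coordinates from `e` to `e'`. -/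
def dTrans (e e' : SmoothChart n M) (k i : Fin n) (x : Coord n) : ℝ :=
  fderiv ℝ (fun x' => transition e e' x' k) x (EuclideanSpace.single i 1)

/-- Second partial derivative `∂²x̄^k/∂x^i∂x^j` of the change of coordinates from `e` to `e'`. -/
def ddTrans (e e' : SmoothChart n M) (k i j : Fin n) (x : Coord n) : ℝ :=
  fderiv ℝ (fun x' => dTrans e e' k j x') x (EuclideanSpace.single i 1)

/-- Smooth homogeneous nonlinear connections on `TM ∖ 0`: smooth positively 1-homogeneous
coefficients `N_i^k(x, y)` in each chart, related by the transformation law of nonlinear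
connections. Outside of the coordinate domain (where they mean nothing) the coefficient functions
are put equal to zero, so that equality of families is equality of connections. -/
structure IsNonlinearConnection (N : CoeffFamily n M) : Prop where
  smooth : ∀ (e : SmoothChart n M) (i k : Fin n),
    ContDiffOn ℝ ∞ (fun p : Coord n × Coord n => N e p.1 p.2 i k) (slitDomain e)
  homogeneous : ∀ (e : SmoothChart n M) (x y : Coord n), (x, y) ∈ slitDomain e →
    ∀ t : ℝ, 0 < t → ∀ i k : Fin n, N e x (t • y) i k = t * N e x y i k
  cocycle : ∀ (e e' : SmoothChart n M) (x y x' y' : Coord n), (x, y) ∈ slitDomain e →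
    e.1.symm x ∈ e'.1.source → x' = transition e e' x →
    (∀ k, y' k = ∑ c, dTrans e e' k c x * y c) →
    ∀ i k : Fin n, N e' x' y' i k =
      ∑ c, ∑ b, dTrans e e' k c x * ddTrans e' e c i b x' * y' b
        + ∑ c, ∑ a, dTrans e e' k c x * dTrans e' e a i x' * N e x y a c
  off_domain : ∀ (e : SmoothChart n M) (x y : Coord n), (x, y) ∉ slitDomain e →
    ∀ i k : Fin n, N e x y i k = 0

/-- `N` is symmetric: its torsion `Tor_{ij}^k = N_{i·j}^k - N_{j·i}^k` vanishes on `TM ∖ 0`. -/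
def IsSymmetric (N : CoeffFamily n M) : Prop :=
  ∀ (e : SmoothChart n M) (x y : Coord n), (x, y) ∈ slitDomain e → ∀ i j k : Fin n,
    dy j (fun x y => N e x y i k) x y - dy i (fun x y => N e x y j k) x y = 0

/-! ### Pseudo-Finsler metrics

`L` is a function on the tangent bundle; its values on the zero section are never used. -/

/-- Coordinate expression `L(x, y)` of `L` in the chart `e`. -/
def localL (L : TangentBundle (𝓡 n) M → ℝ) (e : SmoothChart n M) (x y : Coord n) : ℝ :=
  L (tangentVec e x y)

/-- Fundamental tensor `g_{ij} = L_{·i·j} / 2`. -/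
def fundTensor (L : TangentBundle (𝓡 n) M → ℝ) (e : SmoothChart n M) (x y : Coord n) :
    Matrix (Fin n) (Fin n) ℝ :=
  Matrix.of fun i j => (1 / 2 : ℝ) * dy j (dy i (localL L e)) x y

/-- Pseudo-Finsler metrics on `TM ∖ 0`: smooth positively 2-homogeneous functions with
non-degenerate fundamental tensor. -/
structure IsPseudoFinsler [IsManifold (𝓡 n) ∞ M] (L : TangentBundle (𝓡 n) M → ℝ) : Prop where
  smooth : ContMDiffOn (𝓡 n).tangent 𝓘(ℝ, ℝ) ∞ L {v | v.2 ≠ 0}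
  homogeneous : ∀ (p : M) (v : TangentSpace (𝓡 n) p), v ≠ 0 → ∀ t : ℝ, 0 < t →
    L ⟨p, t • v⟩ = t ^ 2 * L ⟨p, v⟩
  nondegenerate : ∀ (e : SmoothChart n M) (x y : Coord n), (x, y) ∈ slitDomain e →
    (fundTensor L e x y).det ≠ 0

/-- A pseudo-Finsler metric is (positive definite) Riemannian when its fundamental tensor
is isotropic, i.e. depends only on the base point, and positive definite. -/
structure IsRiemannian [IsManifold (𝓡 n) ∞ M] (L : TangentBundle (𝓡 n) M → ℝ) : Prop
    extends IsPseudoFinsler L where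
  isotropic : ∀ (e : SmoothChart n M) (x y y' : Coord n), (x, y) ∈ slitDomain e →
    (x, y') ∈ slitDomain e → fundTensor L e x y = fundTensor L e x y'
  posDef : ∀ (e : SmoothChart n M) (x y : Coord n), (x, y) ∈ slitDomain e →
    (fundTensor L e x y).PosDef

/-- Coefficients of the metric spray,
`(G^L)^i = g^{ia} (2 ∂_c g_{ab} - ∂_a g_{bc}) y^b y^c / 4`. -/
def sprayCoeff (L : TangentBundle (𝓡 n) M → ℝ) (e : SmoothChart n M) (i : Fin n)
    (x y : Coord n) : ℝ :=
  (1 / 4 : ℝ) * ∑ a, ∑ b, ∑ c, (fundTensor L e x y)⁻¹ i a *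
    (2 * dx c (fun x y => fundTensor L e x y a b) x y
      - dx a (fun x y => fundTensor L e x y b c) x y) * y b * y c

open Classical in
/-- The metric nonlinear connection `N^L`, with coefficients `(N^L)_i^k = (G^L)^k_{·i}` on
`TM ∖ 0` (and zero outside of the coordinate domain). -/
def metricConnection (L : TangentBundle (𝓡 n) M → ℝ) : CoeffFamily n M :=
  fun e x y i k => if (x, y) ∈ slitDomain e then dy i (sprayCoeff L e k) x y else 0

/-- `y_a = g_{ab} y^b`. -/
def lowerY (L : TangentBundle (𝓡 n) M → ℝ) (e : SmoothChart n M) (a : Fin n)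
    (x y : Coord n) : ℝ :=
  ∑ b, fundTensor L e x y a b * y b

/-- Cartan tensor `C_{ijk} = g_{ij·k} / 2`. -/
def cartan (L : TangentBundle (𝓡 n) M → ℝ) (e : SmoothChart n M) (i j k : Fin n)
    (x y : Coord n) : ℝ :=
  (1 / 2 : ℝ) * dy k (fun x y => fundTensor L e x y i j) x y

/-- Mean Cartan tensor `C_i = g^{ab} C_{abi}`. -/
def meanCartan (L : TangentBundle (𝓡 n) M → ℝ) (e : SmoothChart n M) (i : Fin n)
    (x y : Coord n) : ℝ :=
  ∑ a, ∑ b, (fundTensor L e x y)⁻¹ a b * cartan L e a b i x y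

/-- Berwald anisotropic connection of `L`: `Γ_{ij}^k = (N^L)_{i·j}^k`. -/
def berwald (L : TangentBundle (𝓡 n) M → ℝ) (e : SmoothChart n M) (i j k : Fin n)
    (x y : Coord n) : ℝ :=
  dy j (fun x y => metricConnection L e x y i k) x y

/-- Horizontal derivative `δ_i f = ∂_i f - (N^L)_i^a f_{·a}`. -/
def horizDeriv (L : TangentBundle (𝓡 n) M → ℝ) (e : SmoothChart n M) (i : Fin n)
    (f : Coord n → Coord n → ℝ) (x y : Coord n) : ℝ :=
  dx i f x y - ∑ a, metricConnection L e x y i a * dy a f x y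

/-- Landsberg tensor `Lan_{ijk} = ∇^L_k g_{ij} / 2`, with `∇^L` the covariant derivative of the
Berwald anisotropic connection of `L`. -/
def landsberg (L : TangentBundle (𝓡 n) M → ℝ) (e : SmoothChart n M) (i j k : Fin n)
    (x y : Coord n) : ℝ :=
  (1 / 2 : ℝ) * (horizDeriv L e k (fun x y => fundTensor L e x y i j) x y
    - ∑ a, berwald L e k i a x y * fundTensor L e x y a j
    - ∑ a, berwald L e k j a x y * fundTensor L e x y i a)

/-- Mean Landsberg tensor `Lan_i = g^{ab} Lan_{abi}`. -/
def meanLandsberg (L : TangentBundle (𝓡 n) M → ℝ) (e : SmoothChart n M) (i : Fin n)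
    (x y : Coord n) : ℝ :=
  ∑ a, ∑ b, (fundTensor L e x y)⁻¹ a b * landsberg L e a b i x y

/-! ### The affine equation -/

/-- `J_i^k = N_i^k - (N^L)_i^k`. -/
def diffTensor (L : TangentBundle (𝓡 n) M → ℝ) (N : CoeffFamily n M) (e : SmoothChart n M)
    (i k : Fin n) (x y : Coord n) : ℝ :=
  N e x y i k - metricConnection L e x y i k

/-- The covector in the affine equation, in terms of `J = N - N^L`:
`2 Lan_b + (n+2) (y_a / L) J_b^a - 2 C_a J_b^a - (J_{b·a}^a + J_{a·b}^a)`. -/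
def affineCovector (L : TangentBundle (𝓡 n) M → ℝ) (N : CoeffFamily n M) (e : SmoothChart n M)
    (b : Fin n) (x y : Coord n) : ℝ :=
  2 * meanLandsberg L e b x y
    + ((n : ℝ) + 2) * ∑ a, lowerY L e a x y / localL L e x y * diffTensor L N e b a x y
    - 2 * ∑ a, meanCartan L e a x y * diffTensor L N e b a x y
    - ∑ a, (dy a (diffTensor L N e b a) x y + dy b (diffTensor L N e a a) x y)

/-- `N` solves the affine equation of the metric-affine (Palatini) functional of `L`, on
`TM ∖ 0`. -/
def SolvesAffineEquation (L : TangentBundle (𝓡 n) M → ℝ) (N : CoeffFamily n M) : Prop :=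
  ∀ (e : SmoothChart n M) (x y : Coord n), (x, y) ∈ slitDomain e → ∀ i j : Fin n,
    (∑ b, affineCovector L N e b x y *
        ((if i = b then 1 else 0) * y j - y b * (if i = j then 1 else 0)))
      - ∑ a, (dy a (diffTensor L N e i j) x y - dy i (diffTensor L N e a j) x y) * y a = 0

/-- The set of symmetric solutions of the affine equation of `L` on `TM ∖ 0`. -/
def symSol (L : TangentBundle (𝓡 n) M → ℝ) : Set (CoeffFamily n M) :=
  {N | IsNonlinearConnection N ∧ SolvesAffineEquation L N ∧ IsSymmetric N}

end Manifold

end FinslerPalatini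

end

noncomputable section
namespace FinslerPalatini

open Filter Topology

/-! ### Partial derivatives on the coordinate space -/

/-! For Riemannian `L` the mean Cartan and mean Landsberg tensors vanish and `N^L` is the nonlinear
connection of the Levi-Civita connection, so existence reduces to classical facts about Christoffel
symbols: symmetry, metric compatibility and the transformation law (`christoffel_pullback`). For
uniqueness, let `J` be the difference of a symmetric solution and `N^L`. By symmetry the last term
of the affine equation drops out, and `covector_eq_zero` leaves `(n+2) y_a J_b^a = 2 L ∂_b D` with
`D = J_a^a`. From here on only one fibre matters. Symmetry and Euler's theorem give a potential `Z^k
= J_a^k y^a / 2` with `∂_i Z^k = J_i^k`. Contracting the trace equation with `y^b` gives `(n+2) y_a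
Z^a = L D`; differentiating this and subtracting the trace equation gives `(n+2) Z_b = 2 y_b D - L
∂_b D`. The divergence of the last identity is `L ΔD = (n-2) D`, where `Δ` is the Laplacian of the
inner product on the fibre (`eq_zero_of_symmetric_of_trace_eq`). As `D` is 1-homogeneous, this says
that its restriction to the unit sphere satisfies `-Δ_S D = D`. The eigenvalues of the sphere are
`k(k+n-2)`, and the first positive one is `n-1 ≥ 2`, so `D = 0`, hence `Z = 0` and `J = 0`. For `n =
2` the linear functions would be eigenfunctions. The spectral fact is proved by a maximum principle
(`auxW_nonpos`). The equation for `D` itself has the wrong sign for this, but the combinations `W_b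
= r² ∂_b D + β D y_b`, for a suitable constant `β`, satisfy an equation with the right sign. -/

/-- Partial derivative of a function on the coordinate space. -/
def pd {n : ℕ} (i : Fin n) (F : Coord n → ℝ) (y : Coord n) : ℝ :=
  fderiv ℝ F y (EuclideanSpace.single i 1)

section Calculus

variable {n : ℕ} {F H : Coord n → ℝ} {U : Set (Coord n)} {y : Coord n}

lemma coord_eq_sum_single (v : Coord n) :
    v = ∑ i, v i • EuclideanSpace.single i (1 : ℝ) := by
  ext j
  simp [Finset.sum_apply, Pi.single_apply]

lemma fderiv_apply_eq_sum_pd {E : Type*} [NormedAddCommGroup E] [NormedSpace ℝ E]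
    (T : Coord n →L[ℝ] E) (v : Coord n) :
    T v = ∑ i, v i • T (EuclideanSpace.single i 1) := by
  conv_lhs => rw [coord_eq_sum_single v]
  simp only [map_sum, map_smul]

lemma fderiv_eq_sum_pd (F : Coord n → ℝ) (y v : Coord n) :
    fderiv ℝ F y v = ∑ i, v i * pd i F y := by
  rw [fderiv_apply_eq_sum_pd (fderiv ℝ F y) v]
  rfl

lemma pd_congr_of_eventuallyEq (i : Fin n) (h : F =ᶠ[𝓝 y] H) : pd i F y = pd i H y := by
  unfold pd
  rw [h.fderiv_eq]

lemma pd_congr_of_eqOn (i : Fin n) (hU : IsOpen U) (h : ∀ z ∈ U, F z = H z) (hy : y ∈ U) :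
    pd i F y = pd i H y :=
  pd_congr_of_eventuallyEq i (Filter.eventually_of_mem (hU.mem_nhds hy) h)

lemma contDiffOn_pd (i : Fin n) (hU : IsOpen U) (hF : ContDiffOn ℝ ∞ F U) :
    ContDiffOn ℝ ∞ (pd i F) U :=
  (hF.fderiv_of_isOpen hU (m := ∞) (by simp)).clm_apply contDiffOn_const

lemma differentiableAt_of_contDiffOn {E E' : Type*} [NormedAddCommGroup E] [NormedSpace ℝ E]
    [NormedAddCommGroup E'] [NormedSpace ℝ E'] {f : E → E'} {s : Set E} {x : E}
    (hU : IsOpen s) (hF : ContDiffOn ℝ ∞ f s) (hy : x ∈ s) : DifferentiableAt ℝ f x :=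
  (hF.contDiffAt (hU.mem_nhds hy)).differentiableAt (by simp)

@[simp] lemma pd_const (i : Fin n) (c : ℝ) : pd i (fun _ => c) y = 0 := by
  simp [pd]

lemma pd_coord (i j : Fin n) : pd i (fun y : Coord n => y j) y = if i = j then 1 else 0 := by
  have h : HasFDerivAt (fun y : Coord n => y j) (EuclideanSpace.proj j : Coord n →L[ℝ] ℝ) y :=
    (EuclideanSpace.proj j : Coord n →L[ℝ] ℝ).hasFDerivAt
  rw [pd, h.fderiv]
  simp [eq_comm]

lemma pd_add (i : Fin n) (hF : DifferentiableAt ℝ F y) (hH : DifferentiableAt ℝ H y) :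
    pd i (fun y => F y + H y) y = pd i F y + pd i H y := by
  simp [pd, fderiv_fun_add hF hH]

lemma pd_sub (i : Fin n) (hF : DifferentiableAt ℝ F y) (hH : DifferentiableAt ℝ H y) :
    pd i (fun y => F y - H y) y = pd i F y - pd i H y := by
  simp [pd, fderiv_fun_sub hF hH]

lemma pd_mul (i : Fin n) (hF : DifferentiableAt ℝ F y) (hH : DifferentiableAt ℝ H y) :
    pd i (fun y => F y * H y) y = F y * pd i H y + pd i F y * H y := by
  simp [pd, fderiv_fun_mul hF hH]; ring

lemma pd_const_mul (i : Fin n) (c : ℝ) (hF : DifferentiableAt ℝ F y) :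
    pd i (fun y => c * F y) y = c * pd i F y := by
  simp [pd, fderiv_const_mul hF]

lemma pd_sum {ι : Type*} (s : Finset ι) (i : Fin n) {f : ι → Coord n → ℝ}
    (hf : ∀ k ∈ s, DifferentiableAt ℝ (f k) y) :
    pd i (fun y => ∑ k ∈ s, f k y) y = ∑ k ∈ s, pd i (f k) y := by
  simp [pd, fderiv_fun_sum hf]

lemma differentiableAt_coord (j : Fin n) : DifferentiableAt ℝ (fun y : Coord n => y j) y :=
  (EuclideanSpace.proj j : Coord n →L[ℝ] ℝ).differentiableAt

lemma contDiff_coord (j : Fin n) : ContDiff ℝ ∞ (fun y : Coord n => y j) :=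
  (EuclideanSpace.proj j : Coord n →L[ℝ] ℝ).contDiff

lemma pd_linear (i : Fin n) (c : Fin n → ℝ) : pd i (fun y => ∑ b, c b * y b) y = c i := by
  rw [pd_sum _ _ fun b _ => (differentiableAt_coord b).const_mul _]
  simp [pd_const_mul _ _ (differentiableAt_coord _), pd_coord]

lemma pd_quadratic (i : Fin n) (c : Fin n → Fin n → ℝ) :
    pd i (fun y => ∑ a, ∑ b, c a b * y a * y b) y = ∑ b, (c i b + c b i) * y b := by
  have hd : ∀ a b, DifferentiableAt ℝ (fun y : Coord n => c a b * y a * y b) y := fun a b =>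
    ((differentiableAt_coord a).const_mul _).mul (differentiableAt_coord b)
  rw [pd_sum _ _ fun a _ => DifferentiableAt.fun_sum fun b _ => hd a b]
  have : ∀ a, pd i (fun y : Coord n => ∑ b, c a b * y a * y b) y
      = ∑ b, (c a b * y a * (if i = b then 1 else 0) + c a b * (if i = a then 1 else 0) * y b) := by
    intro a
    rw [pd_sum _ _ fun b _ => hd a b]
    refine Finset.sum_congr rfl fun b _ => ?_
    rw [pd_mul _ ((differentiableAt_coord a).const_mul _) (differentiableAt_coord b),
      pd_const_mul _ _ (differentiableAt_coord a), pd_coord, pd_coord]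
  simp only [this, Finset.sum_add_distrib, add_mul, mul_ite, mul_one, mul_zero, ite_mul, zero_mul]
  rw [add_comm]
  congr 1
  · rw [Finset.sum_comm]; simp
  · simp

lemma pd_comm (i j : Fin n) (hU : IsOpen U) (hF : ContDiffOn ℝ ∞ F U) (hy : y ∈ U) :
    pd i (pd j F) y = pd j (pd i F) y := by
  have hc : ContDiffAt ℝ ∞ F y := hF.contDiffAt (hU.mem_nhds hy)
  have hs : IsSymmSndFDerivAt ℝ F y := hc.isSymmSndFDerivAt (by
    simp only [minSmoothness_of_isRCLikeNormedField]; exact WithTop.coe_le_coe.mpr le_top)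
  have hd : DifferentiableAt ℝ (fderiv ℝ F) y :=
    differentiableAt_of_contDiffOn hU (hF.fderiv_of_isOpen hU (m := ∞) (by simp)) hy
  have key : ∀ a b : Fin n, pd a (pd b F) y
      = fderiv ℝ (fderiv ℝ F) y (EuclideanSpace.single a 1) (EuclideanSpace.single b 1) := by
    intro a b
    unfold pd
    rw [fderiv_clm_apply hd (differentiableAt_const _)]
    simp
  rw [key, key, hs.eq]

lemma euler_of_homogeneous {k : ℕ} (hF : DifferentiableAt ℝ F y)
    (hom : ∀ t : ℝ, 0 < t → F (t • y) = t ^ k * F y) :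
    ∑ i, y i * pd i F y = k * F y := by
  rw [← fderiv_eq_sum_pd]
  have h1 : HasDerivAt (fun t : ℝ => F (t • y)) (fderiv ℝ F y y) 1 := by
    have h0 : HasDerivAt (fun t : ℝ => t • y) y 1 := by
      simpa using (hasDerivAt_id (1 : ℝ)).smul_const y
    have hF' : HasFDerivAt F (fderiv ℝ F y) ((1 : ℝ) • y) := by
      rw [one_smul]; exact hF.hasFDerivAt
    exact hF'.comp_hasDerivAt (1 : ℝ) h0
  have h2 : HasDerivAt (fun t : ℝ => t ^ k * F y) (k * F y) 1 := by
    simpa using (hasDerivAt_pow k (1 : ℝ)).mul_const (F y)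
  refine h1.unique (h2.congr_of_eventuallyEq ?_)
  filter_upwards [lt_mem_nhds (zero_lt_one' ℝ)] with t ht using hom t ht

lemma isOpen_slit : IsOpen ({0}ᶜ : Set (Coord n)) := isOpen_compl_singleton

lemma pd_homogeneous {k : ℕ} (i : Fin n) (hF : ContDiffOn ℝ ∞ F {0}ᶜ)
    (hom : ∀ y : Coord n, y ≠ 0 → ∀ t : ℝ, 0 < t → F (t • y) = t ^ (k + 1) * F y)
    {y : Coord n} (hy : y ≠ 0) {t : ℝ} (ht : 0 < t) : pd i F (t • y) = t ^ k * pd i F y := by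
  have hty : t • y ≠ 0 := smul_ne_zero ht.ne' hy
  have hd1 := differentiableAt_of_contDiffOn isOpen_slit hF hty
  have hd2 := differentiableAt_of_contDiffOn isOpen_slit hF hy
  have h1 : HasFDerivAt (fun z : Coord n => F (t • z))
      ((fderiv ℝ F (t • y)).comp (t • ContinuousLinearMap.id ℝ (Coord n))) y :=
    hd1.hasFDerivAt.comp y ((hasFDerivAt_id y).const_smul t)
  have h2 : HasFDerivAt (fun z : Coord n => F (t • z)) (t ^ (k + 1) • fderiv ℝ F y) y := by
    refine (hd2.hasFDerivAt.const_mul (t ^ (k + 1))).congr_of_eventuallyEq ?_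
    filter_upwards [isOpen_slit.mem_nhds hy] with z hz using hom z hz t ht
  have h3 := congrArg (fun T : Coord n →L[ℝ] ℝ => T (EuclideanSpace.single i 1)) (h1.unique h2)
  simp only [ContinuousLinearMap.comp_apply, _root_.smul_apply,
    ContinuousLinearMap.id_apply, map_smul, smul_eq_mul] at h3
  exact mul_left_cancel₀ ht.ne'
    (h3.trans (by ring : _ = t * (t ^ k * fderiv ℝ F y (EuclideanSpace.single i 1))))

/-- Second derivative test, necessary condition at a local maximum. -/
lemma pd_pd_nonpos_of_isLocalMax (i : Fin n) (hU : IsOpen U) (hF : ContDiffOn ℝ ∞ F U)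
    (hy : y ∈ U) (hmax : IsLocalMax F y) : pd i (pd i F) y ≤ 0 := by
  -- With a positive second derivative the critical point is also a local minimum along the line
  -- `l`, so `F` is constant along `l` near `y`, and its second derivative there is zero.
  by_contra! hpos
  set v : Coord n := EuclideanSpace.single i 1
  set l : ℝ → Coord n := fun t => y + t • v
  have hl : ∀ t, HasDerivAt l v t := fun t => by
    have h := ((hasDerivAt_id t).smul_const v).const_add y
    rw [one_smul] at h
    exact h
  have hl0 : l 0 = y := by simp [l]
  have hlc : Continuous l := by fun_prop
  have hev : ∀ᶠ t in 𝓝 (0 : ℝ), l t ∈ U :=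
    hlc.continuousAt.eventually (by rw [hl0]; exact hU.mem_nhds hy)
  have hder : ∀ {G : Coord n → ℝ}, ContDiffOn ℝ ∞ G U → ∀ t, l t ∈ U →
      HasDerivAt (fun t => G (l t)) (pd i G (l t)) t := fun hG t ht =>
    (differentiableAt_of_contDiffOn hU hG ht).hasFDerivAt.comp_hasDerivAt t (hl t)
  have hd1 : deriv (fun t => F (l t)) =ᶠ[𝓝 0] fun t => pd i F (l t) := by
    filter_upwards [hev] with t ht using (hder hF t ht).deriv
  have hd2 : deriv (deriv fun t => F (l t)) 0 = pd i (pd i F) y := by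
    rw [hd1.deriv_eq, (hder (contDiffOn_pd i hU hF) 0 (by rwa [hl0])).deriv, hl0]
  have hmax' : IsLocalMax (fun t => F (l t)) 0 := by
    have : Tendsto l (𝓝 0) (𝓝 y) := by simpa [hl0] using hlc.tendsto 0
    have h := this.eventually hmax
    filter_upwards [h] with t ht
    simpa [hl0] using ht
  have hmin : IsLocalMin (fun t => F (l t)) 0 :=
    isLocalMin_of_deriv_deriv_pos (by rw [hd2]; exact hpos) hmax'.deriv_eq_zero
      (hder hF 0 (by rwa [hl0])).continuousAt
  have hconst : (fun t => F (l t)) =ᶠ[𝓝 0] fun _ => F (l 0) := by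
    filter_upwards [hmax', hmin] with t h1 h2 using le_antisymm h1 h2
  have : deriv (deriv fun t => F (l t)) 0 = 0 := by
    rw [hconst.deriv.deriv_eq]; simp
  rw [hd2] at this
  exact hpos.ne' this

end Calculus
-- The sphere has no eigenvalue `1` in dimension at least three: Euclidean case.
section Laplace

variable {n : ℕ}

/-- The squared Euclidean norm in coordinates. -/
def sqNorm (y : Coord n) : ℝ := ∑ a, y a * y a

lemma sqNorm_eq (y : Coord n) : sqNorm y = ‖y‖ ^ 2 := by
  rw [EuclideanSpace.norm_sq_eq]
  simp [sqNorm, sq]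

lemma contDiff_sqNorm : ContDiff ℝ ∞ (sqNorm : Coord n → ℝ) :=
  ContDiff.sum fun a _ => (contDiff_coord a).mul (contDiff_coord a)

lemma pd_sqNorm (i : Fin n) (y : Coord n) : pd i sqNorm y = 2 * y i := by
  unfold sqNorm
  rw [pd_sum _ _ fun a _ => (differentiableAt_coord a).fun_mul (differentiableAt_coord a)]
  simp only [pd_mul _ (differentiableAt_coord _) (differentiableAt_coord _), pd_coord]
  simp [Finset.sum_add_distrib]; ring

/-- The auxiliary function `r² ∂_b D + β D y_b`. -/
def auxW (β : ℝ) (D : Coord n → ℝ) (b : Fin n) (y : Coord n) : ℝ :=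
  sqNorm y * pd b D y + β * (D y * y b)

variable {D : Coord n → ℝ} {β : ℝ}

lemma contDiffOn_auxW (hD : ContDiffOn ℝ ∞ D {0}ᶜ) (b : Fin n) :
    ContDiffOn ℝ ∞ (auxW β D b) {0}ᶜ :=
  (contDiff_sqNorm.contDiffOn.mul (contDiffOn_pd b isOpen_slit hD)).add
    (contDiffOn_const.mul (hD.mul (contDiff_coord b).contDiffOn))

lemma pd_auxW (hD : ContDiffOn ℝ ∞ D {0}ᶜ) (a b : Fin n) {y : Coord n} (hy : y ≠ 0) :
    pd a (auxW β D b) y = sqNorm y * pd a (pd b D) y + 2 * y a * pd b D y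
      + β * (D y * (if a = b then 1 else 0) + pd a D y * y b) := by
  have hd := differentiableAt_of_contDiffOn isOpen_slit hD hy
  have hdb := differentiableAt_of_contDiffOn isOpen_slit (contDiffOn_pd b isOpen_slit hD) hy
  have hr : DifferentiableAt ℝ (sqNorm : Coord n → ℝ) y :=
    contDiff_sqNorm.differentiable (by simp) y
  have hb : DifferentiableAt ℝ (fun y : Coord n => y b) y := differentiableAt_coord b
  unfold auxW
  rw [pd_add _ (hr.fun_mul hdb) ((hd.fun_mul hb).const_mul _), pd_mul _ hr hdb,
    pd_const_mul _ _ (hd.fun_mul hb), pd_mul _ hd hb, pd_sqNorm, pd_coord]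

lemma pd_pd_auxW (hD : ContDiffOn ℝ ∞ D {0}ᶜ) (a b : Fin n) {y : Coord n} (hy : y ≠ 0) :
    pd a (pd a (auxW β D b)) y = sqNorm y * pd a (pd a (pd b D)) y
      + 4 * (y a * pd a (pd b D) y) + 2 * pd b D y
      + β * (2 * (pd a D y * (if a = b then 1 else 0)) + pd a (pd a D) y * y b) := by
  have hD' := contDiffOn_pd a isOpen_slit hD
  have hDb := contDiffOn_pd b isOpen_slit hD
  have hd := differentiableAt_of_contDiffOn isOpen_slit hD hy
  have hda := differentiableAt_of_contDiffOn isOpen_slit hD' hy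
  have hdb := differentiableAt_of_contDiffOn isOpen_slit hDb hy
  have hdab := differentiableAt_of_contDiffOn isOpen_slit (contDiffOn_pd a isOpen_slit hDb) hy
  have hr : DifferentiableAt ℝ (sqNorm : Coord n → ℝ) y :=
    contDiff_sqNorm.differentiable (by simp) y
  have hb : DifferentiableAt ℝ (fun y : Coord n => y b) y := differentiableAt_coord b
  have ha : DifferentiableAt ℝ (fun y : Coord n => 2 * y a) y :=
    (differentiableAt_coord a).const_mul _
  have hc : DifferentiableAt ℝ (fun _ : Coord n => (if a = b then (1 : ℝ) else 0)) y :=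
    differentiableAt_const _
  rw [pd_congr_of_eqOn a isOpen_slit (fun z hz => pd_auxW hD a b hz) hy,
    pd_add _ ((hr.fun_mul hdab).fun_add (ha.fun_mul hdb)) (((hd.fun_mul hc).fun_add (hda.fun_mul hb)).const_mul _),
    pd_add _ (hr.fun_mul hdab) (ha.fun_mul hdb), pd_mul _ hr hdab, pd_mul _ ha hdb,
    pd_const_mul _ _ ((hd.fun_mul hc).fun_add (hda.fun_mul hb)), pd_add _ (hd.fun_mul hc) (hda.fun_mul hb),
    pd_mul _ hd hc, pd_mul _ hda hb, pd_const_mul _ _ (differentiableAt_coord a), pd_const,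
    pd_coord, pd_coord, pd_sqNorm]
  simp only [if_true]
  ring

/-- On the unit sphere the Laplacian of `auxW β D b` is a combination of `∂_b D` and `D y_b`; the
quadratic equation for `β` says exactly that these occur in the ratio `1 : β`. The excess `n - 2 +
2β` over `2n` is what the maximum principle uses: `2n` is the Laplacian of `r²`. -/
lemma laplace_auxW (hD : ContDiffOn ℝ ∞ D {0}ᶜ)
    (hom : ∀ y : Coord n, y ≠ 0 → ∀ t : ℝ, 0 < t → D (t • y) = t * D y)
    (pde : ∀ y : Coord n, y ≠ 0 → sqNorm y * ∑ a, pd a (pd a D) y = (n - 2) * D y)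
    (hβ : β ^ 2 + n * β + (n - 2) = 0) (b : Fin n) {y : Coord n} (hy : y ≠ 0)
    (h1 : sqNorm y = 1) :
    ∑ a, pd a (pd a (auxW β D b)) y = (2 * n + (n - 2 + 2 * β)) * auxW β D b y := by
  have hDb := contDiffOn_pd b isOpen_slit hD
  have hDaa : ∀ a, ContDiffOn ℝ ∞ (pd a (pd a D)) {0}ᶜ := fun a =>
    contDiffOn_pd a isOpen_slit (contDiffOn_pd a isOpen_slit hD)
  have hdaa : ∀ a, DifferentiableAt ℝ (pd a (pd a D)) y := fun a =>
    differentiableAt_of_contDiffOn isOpen_slit (hDaa a) hy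
  -- The first derivatives of `D` are 0-homogeneous.
  have e1 : ∑ a, y a * pd a (pd b D) y = 0 := by
    have := euler_of_homogeneous (k := 0) (differentiableAt_of_contDiffOn isOpen_slit hDb hy)
      (fun t ht => pd_homogeneous (k := 0) b hD (fun y hy t ht => by simpa using hom y hy t ht)
        hy ht)
    simpa using this
  have e2 : ∑ a, pd a (pd a (pd b D)) y = pd b (fun z => ∑ a, pd a (pd a D) z) y := by
    rw [pd_sum _ _ fun a _ => hdaa a]
    refine Finset.sum_congr rfl fun a _ => ?_
    rw [pd_congr_of_eqOn a isOpen_slit (fun z hz => pd_comm a b isOpen_slit hD hz) hy]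
    exact pd_comm a b isOpen_slit (contDiffOn_pd a isOpen_slit hD) hy
  -- This is the `b`-th derivative of the equation for `D`; it controls the third-order terms.
  have e3 : sqNorm y * pd b (fun z => ∑ a, pd a (pd a D) z) y
      + 2 * y b * ∑ a, pd a (pd a D) y = (n - 2) * pd b D y := by
    have hr : DifferentiableAt ℝ (sqNorm : Coord n → ℝ) y :=
      contDiff_sqNorm.differentiable (by simp) y
    rw [← pd_const_mul _ _ (differentiableAt_of_contDiffOn isOpen_slit hD hy),
      ← pd_congr_of_eqOn b isOpen_slit pde hy,
      pd_mul _ hr (DifferentiableAt.fun_sum fun a _ => hdaa a), pd_sqNorm]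
  have e4 := pde y hy
  simp only [pd_pd_auxW hD _ b hy, Finset.sum_add_distrib, ← Finset.mul_sum, ← Finset.sum_mul,
    e1, e2, mul_ite, mul_one, mul_zero, Finset.sum_ite_eq', Finset.mem_univ, if_true,
    Finset.sum_const, Finset.card_univ, Fintype.card_fin, nsmul_eq_mul]
  unfold auxW
  rw [h1] at e3 e4 ⊢
  rw [one_mul] at e3 e4
  rw [e4] at e3 ⊢
  linear_combination e3 - 2 * D y * y b * hβ

/-- Maximum principle. Let `m` be the maximum of the 2-homogeneous function `W = auxW β D b` on the
unit sphere, attained at `y₀`. By homogeneity `W - m r² ≤ 0` off the origin, with equality at `y₀`,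
so `ΔW ≤ 2 n m` there. By `laplace_auxW` the left side is `(2n + μ) m` with `μ = n - 2 + 2β > 0`,
which forces `m ≤ 0`. -/
lemma auxW_nonpos (hD : ContDiffOn ℝ ∞ D {0}ᶜ)
    (hom : ∀ y : Coord n, y ≠ 0 → ∀ t : ℝ, 0 < t → D (t • y) = t * D y)
    (pde : ∀ y : Coord n, y ≠ 0 → sqNorm y * ∑ a, pd a (pd a D) y = (n - 2) * D y)
    (hβ : β ^ 2 + n * β + (n - 2) = 0) (hμ : 0 < n - 2 + 2 * β) (b : Fin n) {y : Coord n}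
    (hy : y ≠ 0) : auxW β D b y ≤ 0 := by
  have hW : ContDiffOn ℝ ∞ (auxW β D b) {0}ᶜ := contDiffOn_auxW hD b
  have hsph : ∀ z ∈ Metric.sphere (0 : Coord n) 1, z ≠ 0 := fun z hz h => by
    simp [h] at hz
  have hunit : ∀ z : Coord n, z ≠ 0 → ‖z‖⁻¹ • z ∈ Metric.sphere (0 : Coord n) 1 := fun z hz => by
    simp [norm_smul, hz]
  have homW : ∀ z : Coord n, z ≠ 0 → ∀ t : ℝ, 0 < t →
      auxW β D b (t • z) = t ^ 2 * auxW β D b z := by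
    intro z hz t ht
    have := pd_homogeneous (k := 0) b hD (fun y hy t ht => by simpa using hom y hy t ht) hz ht
    simp only [auxW, hom z hz t ht, this, sqNorm_eq, norm_smul, Real.norm_eq_abs, mul_pow, sq_abs,
      PiLp.smul_apply, smul_eq_mul]
    ring
  obtain ⟨y₀, hy₀, hmax⟩ := (isCompact_sphere (0 : Coord n) 1).exists_isMaxOn ⟨_, hunit y hy⟩
    (hW.continuousOn.mono hsph)
  have hy₀0 := hsph y₀ hy₀
  have hr₀ : sqNorm y₀ = 1 := by rw [sqNorm_eq]; simp_all
  set m := auxW β D b y₀ with hm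
  have hle : ∀ z : Coord n, z ≠ 0 → auxW β D b z ≤ m * sqNorm z := by
    intro z hz
    have h0 : 0 < ‖z‖ := norm_pos_iff.mpr hz
    have h2 := homW (‖z‖⁻¹ • z) (smul_ne_zero (inv_ne_zero h0.ne') hz) ‖z‖ h0
    rw [smul_smul, mul_inv_cancel₀ h0.ne', one_smul] at h2
    rw [h2, sqNorm_eq, mul_comm]
    exact mul_le_mul_of_nonneg_right (hmax (hunit z hz)) (by positivity)
  have hms : ContDiff ℝ ∞ fun z : Coord n => m * sqNorm z := contDiff_const.mul contDiff_sqNorm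
  have hloc : IsLocalMax (fun z => auxW β D b z - m * sqNorm z) y₀ := by
    filter_upwards [isOpen_slit.mem_nhds hy₀0] with z hz
    rw [hr₀, mul_one, sub_self]
    exact sub_nonpos.mpr (hle z hz)
  have hlap : ∀ a, pd a (pd a (auxW β D b)) y₀ ≤ 2 * m := by
    intro a
    have h := pd_pd_nonpos_of_isLocalMax a isOpen_slit (hW.sub hms.contDiffOn) hy₀0 hloc
    have hd : ∀ z : Coord n, z ∈ ({0}ᶜ : Set (Coord n)) →
        pd a (fun z => auxW β D b z - m * sqNorm z) z
          = pd a (auxW β D b) z - m * (2 * z a) := by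
      intro z hz
      rw [pd_sub _ (differentiableAt_of_contDiffOn isOpen_slit hW hz)
        (hms.differentiable (by simp) z),
        pd_const_mul _ _ (contDiff_sqNorm.differentiable (by simp) z), pd_sqNorm]
    have ha : DifferentiableAt ℝ (fun z : Coord n => 2 * z a) y₀ :=
      (differentiableAt_coord a).const_mul _
    rw [pd_congr_of_eqOn a isOpen_slit hd hy₀0,
      pd_sub _ (differentiableAt_of_contDiffOn isOpen_slit (contDiffOn_pd a isOpen_slit hW) hy₀0)
        (ha.const_mul _), pd_const_mul _ _ ha, pd_const_mul _ _ (differentiableAt_coord a),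
      pd_coord, if_pos rfl] at h
    linarith
  have hsum := Finset.sum_le_sum fun a (_ : a ∈ Finset.univ) => hlap a
  rw [laplace_auxW hD hom pde hβ b hy₀0 hr₀, ← hm, Finset.sum_const, Finset.card_univ,
    Fintype.card_fin, nsmul_eq_mul] at hsum
  have hm0 : m ≤ 0 := by
    by_contra! hpos
    nlinarith [mul_pos hμ hpos]
  refine (hle y hy).trans (mul_nonpos_of_nonpos_of_nonneg hm0 ?_)
  rw [sqNorm_eq]; positivity

/-- The larger root is taken, with discriminant `n² - 4(n-2) = (n-2)² + 4 = s²`. Then `n - 2 + 2β =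
s - 2`, which is positive because `n ≠ 2`. -/
lemma exists_exponent (hn : 3 ≤ n) :
    ∃ β : ℝ, β ^ 2 + n * β + (n - 2) = 0 ∧ 0 < n - 2 + 2 * β ∧ 1 + β ≠ 0 := by
  have hn' : (3 : ℝ) ≤ n := by exact_mod_cast hn
  set s := √(((n : ℝ) - 2) ^ 2 + 4) with hs
  have hs2 : s ^ 2 = ((n : ℝ) - 2) ^ 2 + 4 := Real.sq_sqrt (by positivity)
  have hs0 : 0 ≤ s := Real.sqrt_nonneg _
  refine ⟨(-n + s) / 2, by linear_combination hs2 / 4, ?_, fun h => ?_⟩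
  · have : 2 < s := by nlinarith
    linarith
  · have : s = n - 2 := by linarith
    rw [this] at hs2
    linarith

/-- In dimension at least three, `1` is not an eigenvalue of the Laplacian of the sphere:
a homogeneous function of degree one satisfying the corresponding equation vanishes. -/
theorem eq_zero_of_laplace_eq (hn : 3 ≤ n) (hD : ContDiffOn ℝ ∞ D {0}ᶜ)
    (hom : ∀ y : Coord n, y ≠ 0 → ∀ t : ℝ, 0 < t → D (t • y) = t * D y)
    (pde : ∀ y : Coord n, y ≠ 0 → sqNorm y * ∑ a, pd a (pd a D) y = (n - 2) * D y)
    {y : Coord n} (hy : y ≠ 0) : D y = 0 := by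
  obtain ⟨β, hβ, hμ, hβ1⟩ := exists_exponent hn
  have hneg : ∀ b, ∀ z : Coord n, z ≠ 0 → pd b (fun z => -1 * D z) z = -1 * pd b D z :=
    fun b z hz => pd_const_mul _ _ (differentiableAt_of_contDiffOn isOpen_slit hD hz)
  -- The equation is linear, so the one-sided bound also applies to `-D`.
  have hW : ∀ b, auxW β D b y = 0 := by
    intro b
    refine le_antisymm (auxW_nonpos hD hom pde hβ hμ b hy) ?_
    have h := auxW_nonpos (D := fun z => -1 * D z) (β := β) (contDiffOn_const.mul hD)
      (fun z hz t ht => by rw [hom z hz t ht]; ring) (fun z hz => ?_) hβ hμ b hy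
    · simp only [auxW, hneg b y hy] at h ⊢
      linarith
    · have : ∀ a, pd a (pd a fun z => -1 * D z) z = -1 * pd a (pd a D) z := by
        intro a
        rw [pd_congr_of_eqOn a isOpen_slit (fun w hw => hneg a w hw) hz]
        exact pd_const_mul _ _ (differentiableAt_of_contDiffOn isOpen_slit
          (contDiffOn_pd a isOpen_slit hD) hz)
      simp only [this, ← Finset.mul_sum]
      linear_combination -1 * pde z hz
  have e : ∑ a, y a * pd a D y = D y := by
    simpa using euler_of_homogeneous (k := 1) (differentiableAt_of_contDiffOn isOpen_slit hD hy)
      (fun t ht => by simpa using hom y hy t ht)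
  -- Contraction with `y` recovers `D` by Euler's identity; this is where `1 + β ≠ 0` is needed.
  have hs : ∑ b, y b * auxW β D b y = sqNorm y * ((1 + β) * D y) := by
    have : ∀ b, y b * auxW β D b y
        = sqNorm y * (y b * pd b D y) + β * D y * (y b * y b) := fun b => by
      unfold auxW; ring
    simp only [this, Finset.sum_add_distrib, ← Finset.mul_sum, e]
    change _ + β * D y * sqNorm y = _
    ring
  simp only [hW, mul_zero, Finset.sum_const_zero] at hs
  have hr : sqNorm y ≠ 0 := by rw [sqNorm_eq]; simpa using hy
  simpa [hr, hβ1] using hs.symm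

end Laplace
-- Reduction of an arbitrary inner product to the Euclidean one.
section MetricLaplace

open scoped MatrixOrder

variable {n : ℕ}

lemma toEuclideanCLM_apply (C : Matrix (Fin n) (Fin n) ℝ) (z : Coord n) (a : Fin n) :
    Matrix.toEuclideanCLM (𝕜 := ℝ) C z a = ∑ k, C a k * z k := by
  rw [Matrix.ofLp_toEuclideanCLM]
  rfl

lemma pd_comp_toEuclideanCLM {F : Coord n → ℝ} (C : Matrix (Fin n) (Fin n) ℝ) (k : Fin n)
    {z : Coord n} (hF : DifferentiableAt ℝ F (Matrix.toEuclideanCLM (𝕜 := ℝ) C z)) :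
    pd k (fun z => F (Matrix.toEuclideanCLM (𝕜 := ℝ) C z)) z
      = ∑ a, C a k * pd a F (Matrix.toEuclideanCLM (𝕜 := ℝ) C z) := by
  have h := hF.hasFDerivAt.comp z (Matrix.toEuclideanCLM (𝕜 := ℝ) C).hasFDerivAt
  have h' := h.fderiv
  unfold pd at *
  change fderiv ℝ (F ∘ _) z _ = _
  rw [h', ContinuousLinearMap.comp_apply, fderiv_eq_sum_pd]
  refine Finset.sum_congr rfl fun a _ => ?_
  rw [toEuclideanCLM_apply]
  simp [pd]

/-- The version of `eq_zero_of_laplace_eq` for an arbitrary inner product. -/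
theorem eq_zero_of_metric_laplace_eq (hn : 3 ≤ n) {G : Matrix (Fin n) (Fin n) ℝ} (hG : G.PosDef)
    {D : Coord n → ℝ} (hD : ContDiffOn ℝ ∞ D {0}ᶜ)
    (hom : ∀ y : Coord n, y ≠ 0 → ∀ t : ℝ, 0 < t → D (t • y) = t * D y)
    (pde : ∀ y : Coord n, y ≠ 0 →
      (∑ a, ∑ b, G a b * y a * y b) * ∑ a, ∑ b, G⁻¹ a b * pd a (pd b D) y = (n - 2) * D y)
    {y : Coord n} (hy : y ≠ 0) : D y = 0 := by
  -- In the linear coordinates given by `B` the form `G` becomes `sqNorm`, and since `G⁻¹ = C * Cᵀ`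
  -- with `C = B⁻¹`, the Laplacian of `G` becomes the Euclidean one. The Euclidean theorem therefore
  -- applies to `D ∘ T`, where `T` is the map of `C`.
  obtain ⟨B, hB⟩ : ∃ B : Matrix (Fin n) (Fin n) ℝ, G = Bᵀ * B := by
    obtain ⟨B, hB⟩ := CStarAlgebra.nonneg_iff_eq_star_mul_self.mp hG.posSemidef.nonneg
    exact ⟨B, by
      rw [hB, Matrix.star_eq_conjTranspose, Matrix.conjTranspose_eq_transpose_of_trivial]⟩
  have hBu : IsUnit B.det := by
    have := hG.det_pos
    rw [hB, Matrix.det_mul, Matrix.det_transpose] at this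
    exact isUnit_iff_ne_zero.mpr fun h => by simp [h] at this
  set C := B⁻¹ with hC
  have hBC : B * C = 1 := Matrix.mul_nonsing_inv _ hBu
  have hCB : C * B = 1 := Matrix.nonsing_inv_mul _ hBu
  have hGi : G⁻¹ = C * Cᵀ := by
    rw [hB, Matrix.mul_inv_rev, Matrix.transpose_nonsing_inv]
  set T := Matrix.toEuclideanCLM (𝕜 := ℝ) C with hT
  have hTS : ∀ z : Coord n, T (Matrix.toEuclideanCLM (𝕜 := ℝ) B z) = z := fun z => by
    rw [← _root_.mul_apply_eq_comp, hT, ← map_mul, hCB, map_one]; rfl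
  have hST : ∀ z : Coord n, Matrix.toEuclideanCLM (𝕜 := ℝ) B (T z) = z := fun z => by
    rw [← _root_.mul_apply_eq_comp, hT, ← map_mul, hBC, map_one]; rfl
  have hT0 : ∀ z : Coord n, z ≠ 0 → T z ≠ 0 := fun z hz h => hz <| by
    rw [← hST z, h, map_zero]
  have hmaps : Set.MapsTo T {0}ᶜ {0}ᶜ := hT0
  have hpd : ∀ F : Coord n → ℝ, ContDiffOn ℝ ∞ F {0}ᶜ → ∀ k, ∀ z : Coord n, z ≠ 0 →
      pd k (fun z => F (T z)) z = ∑ a, C a k * pd a F (T z) := fun F hF k z hz =>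
    pd_comp_toEuclideanCLM C k (differentiableAt_of_contDiffOn isOpen_slit hF (hT0 z hz))
  have hcomp : ∀ F : Coord n → ℝ, ContDiffOn ℝ ∞ F {0}ᶜ →
      ContDiffOn ℝ ∞ (fun z => F (T z)) {0}ᶜ := fun F hF =>
    hF.comp T.contDiff.contDiffOn hmaps
  have hy' : Matrix.toEuclideanCLM (𝕜 := ℝ) B y ≠ 0 := fun h => hy <| by
    rw [← hTS y, h, map_zero]
  have main := eq_zero_of_laplace_eq (D := fun z => D (T z)) hn (hcomp D hD)
    (fun z hz t ht => by rw [map_smul]; exact hom _ (hT0 z hz) t ht) (fun z hz => ?_) hy'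
  · simpa [hTS] using main
  rw [← pde (T z) (hT0 z hz)]
  congr 1
  · conv_lhs => rw [← hST z]
    simp only [hB, Matrix.mul_apply, sqNorm, toEuclideanCLM_apply, Finset.sum_mul_sum,
      Matrix.transpose_apply]
    simp only [Finset.sum_mul]
    rw [Finset.sum_comm]
    refine Finset.sum_congr rfl fun a _ => ?_
    rw [Finset.sum_comm]
    exact Finset.sum_congr rfl fun b _ => Finset.sum_congr rfl fun k _ => by ring
  · have h2 : ∀ k, pd k (pd k fun z => D (T z)) z
        = ∑ a, ∑ b, C a k * C b k * pd a (pd b D) (T z) := by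
      intro k
      have hDb : ∀ b, ContDiffOn ℝ ∞ (pd b D) {0}ᶜ := fun b => contDiffOn_pd b isOpen_slit hD
      have hd : ∀ b, DifferentiableAt ℝ (fun z => pd b D (T z)) z := fun b =>
        differentiableAt_of_contDiffOn isOpen_slit (hcomp _ (hDb b)) hz
      rw [pd_congr_of_eqOn k isOpen_slit (fun w hw => hpd D hD k w hw) hz,
        pd_sum _ _ fun b _ => (hd b).const_mul _, Finset.sum_comm]
      refine Finset.sum_congr rfl fun b _ => ?_
      rw [pd_const_mul _ _ (hd b), hpd _ (hDb b) k z hz, Finset.mul_sum]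
      exact Finset.sum_congr rfl fun a _ => by ring
    simp only [h2]
    rw [Finset.sum_comm]
    refine Finset.sum_congr rfl fun a _ => ?_
    rw [Finset.sum_comm]
    refine Finset.sum_congr rfl fun b _ => ?_
    rw [hGi, Matrix.mul_apply, Finset.sum_mul]
    rfl

end MetricLaplace
-- Smoothness and homogeneity of `L` in natural coordinates.
section Charts

variable {n : ℕ} {M : Type*} [TopologicalSpace M] [ChartedSpace (Coord n) M]

lemma isOpen_slitDomain (e : SmoothChart n M) : IsOpen (slitDomain e) :=
  e.1.open_target.prod isOpen_slit

lemma SmoothChart.mdifferentiable (e : SmoothChart n M) : e.1.MDifferentiable (𝓡 n) (𝓡 n) :=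
  ⟨(contMDiffOn_of_mem_maximalAtlas e.2).mdifferentiableOn (by simp),
    (contMDiffOn_symm_of_mem_maximalAtlas e.2).mdifferentiableOn (by simp)⟩

lemma mfderiv_symm_ne_zero (e : SmoothChart n M) {x y : Coord n} (h : (x, y) ∈ slitDomain e) :
    (tangentVec e x y).2 ≠ 0 := by
  intro h0
  have hinj := e.mdifferentiable.symm.mfderiv_injective (x := x) h.1
  exact h.2 (hinj (h0.trans (map_zero _).symm))

lemma contMDiff_mk_tangentBundle :
    ContMDiff 𝓘(ℝ, Coord n × Coord n) (𝓡 n).tangent ∞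
      (fun p : Coord n × Coord n => (⟨p.1, p.2⟩ : TangentBundle (𝓡 n) (Coord n))) := by
  have h := contMDiff_tangentBundleModelSpaceHomeomorph_symm (I := 𝓡 n) (n := ∞)
  rw [modelWithCornersSelf_prod]
  exact h

variable [IsManifold (𝓡 n) ∞ M]

/-- This is the tangent map of the inverse chart, precomposed with the identification of `Coord n ×
Coord n` with the tangent bundle of the model space. It transfers the intrinsic smoothness of `L` to
coordinates. -/
lemma contMDiffOn_tangentVec (e : SmoothChart n M) :
    ContMDiffOn 𝓘(ℝ, Coord n × Coord n) (𝓡 n).tangent ∞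
      (fun p : Coord n × Coord n => tangentVec e p.1 p.2) (slitDomain e) := by
  have : IsManifold (𝓡 n) 1 M := .of_le (n := ∞) (by simp)
  have h := (contMDiffOn_symm_of_mem_maximalAtlas e.2).contMDiffOn_tangentMapWithin (m := ∞)
    (by simp) e.1.open_target.uniqueMDiffOn
  have h2 := h.comp (contMDiff_mk_tangentBundle (n := n)).contMDiffOn (s := slitDomain e)
    (fun p hp => hp.1)
  refine h2.congr fun p hp => ?_
  simp only [Function.comp, tangentMapWithin, tangentVec]
  rw [mfderivWithin_of_isOpen e.1.open_target hp.1]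

lemma contDiffOn_localL {L : TangentBundle (𝓡 n) M → ℝ} (hL : IsPseudoFinsler L)
    (e : SmoothChart n M) :
    ContDiffOn ℝ ∞ (fun p : Coord n × Coord n => localL L e p.1 p.2) (slitDomain e) := by
  rw [← contMDiffOn_iff_contDiffOn]
  exact hL.smooth.comp (contMDiffOn_tangentVec e) fun p hp => mfderiv_symm_ne_zero e hp

lemma localL_homogeneous {L : TangentBundle (𝓡 n) M → ℝ} (hL : IsPseudoFinsler L)
    (e : SmoothChart n M) {x y : Coord n} (h : (x, y) ∈ slitDomain e) {t : ℝ} (ht : 0 < t) :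
    localL L e x (t • y) = t ^ 2 * localL L e x y := by
  have := hL.homogeneous _ _ (mfderiv_symm_ne_zero e h) t ht
  have hs : tangentVec e x (t • y) = ⟨e.1.symm x, t • (tangentVec e x y).2⟩ :=
    congrArg (fun v => (⟨e.1.symm x, v⟩ : TangentBundle (𝓡 n) M))
      ((mfderiv (𝓡 n) (𝓡 n) e.1.symm x).map_smul t y)
  rw [localL, hs]
  exact this

end Charts
/-! ### Christoffel symbols -/

section Christoffel

variable {n : ℕ}

/-- Christoffel symbols `Γ^k_{ij}` of a matrix-valued function on the coordinate space. -/
def christoffel (G : Coord n → Matrix (Fin n) (Fin n) ℝ) (k i j : Fin n) (x : Coord n) : ℝ :=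
  ∑ a, (G x)⁻¹ k a * ((1 / 2 : ℝ) * (pd i (fun x => G x a j) x + pd j (fun x => G x a i) x
    - pd a (fun x => G x i j) x))

/-- A smooth Riemannian metric on an open set of the coordinate space. -/
structure IsLocalMetric (G : Coord n → Matrix (Fin n) (Fin n) ℝ) (U : Set (Coord n)) : Prop where
  isOpen : IsOpen U
  smooth : ∀ i j, ContDiffOn ℝ ∞ (fun x => G x i j) U
  posDef : ∀ x ∈ U, (G x).PosDef

variable {G : Coord n → Matrix (Fin n) (Fin n) ℝ} {U : Set (Coord n)} {x : Coord n}

lemma IsLocalMetric.symm (h : IsLocalMetric G U) (hx : x ∈ U) (i j : Fin n) :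
    G x i j = G x j i := by
  simpa using (h.posDef x hx).isHermitian.apply j i

lemma IsLocalMetric.isUnit_det (h : IsLocalMetric G U) (hx : x ∈ U) : IsUnit (G x).det :=
  isUnit_iff_ne_zero.mpr (h.posDef x hx).det_pos.ne'

lemma IsLocalMetric.pd_symm (h : IsLocalMetric G U) (hx : x ∈ U) (i j k : Fin n) :
    pd k (fun x => G x i j) x = pd k (fun x => G x j i) x :=
  pd_congr_of_eqOn k h.isOpen (fun _ hz => h.symm hz i j) hx

lemma IsLocalMetric.christoffel_symm (h : IsLocalMetric G U) (hx : x ∈ U) (k i j : Fin n) :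
    christoffel G k i j x = christoffel G k j i x := by
  unfold christoffel
  refine Finset.sum_congr rfl fun a _ => ?_
  rw [h.pd_symm hx i j a]
  ring

lemma IsLocalMetric.sum_mul_inv (h : IsLocalMetric G U) (hx : x ∈ U) (v : Fin n → ℝ)
    (l : Fin n) : ∑ k, G x l k * ∑ a, (G x)⁻¹ k a * v a = v l := by
  have := congrFun (Matrix.mulVec_mulVec v (G x) (G x)⁻¹) l
  rw [Matrix.mul_nonsing_inv _ (h.isUnit_det hx), Matrix.one_mulVec] at this
  exact this

lemma IsLocalMetric.sum_mul_christoffel (h : IsLocalMetric G U) (hx : x ∈ U) (l i j : Fin n) :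
    ∑ k, G x l k * christoffel G k i j x
      = (1 / 2 : ℝ) * (pd i (fun x => G x l j) x + pd j (fun x => G x l i) x
        - pd l (fun x => G x i j) x) :=
  h.sum_mul_inv hx _ l

/-- Lower indices can be cancelled. -/
lemma IsLocalMetric.cancel (h : IsLocalMetric G U) (hx : x ∈ U) {v w : Fin n → ℝ}
    (hvw : ∀ l, ∑ k, G x l k * v k = ∑ k, G x l k * w k) : v = w := by
  have hvw' : G x *ᵥ v = G x *ᵥ w := funext hvw
  have := congrArg ((G x)⁻¹ *ᵥ ·) hvw'
  simpa [Matrix.mulVec_mulVec, Matrix.nonsing_inv_mul _ (h.isUnit_det hx)] using this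

/-- Cramer's rule: the entries are quotients of determinants, which are polynomial in the entries of
`G`. -/
lemma IsLocalMetric.contDiffOn_inv (h : IsLocalMetric G U) (i j : Fin n) :
    ContDiffOn ℝ ∞ (fun x => (G x)⁻¹ i j) U := by
  have hdet : ∀ A : Coord n → Matrix (Fin n) (Fin n) ℝ,
      (∀ i j, ContDiffOn ℝ ∞ (fun x => A x i j) U) → ContDiffOn ℝ ∞ (fun x => (A x).det) U := by
    intro A hA
    simp only [Matrix.det_apply]
    refine ContDiffOn.sum fun σ _ => ?_
    exact ContDiffOn.const_smul _ (contDiffOn_prod fun i _ => hA _ _)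
  simp only [Matrix.inv_def, Ring.inverse_eq_inv', Matrix.smul_apply, smul_eq_mul,
    Matrix.adjugate_apply]
  refine ((hdet G h.smooth).inv fun x hx => (h.posDef x hx).det_pos.ne').mul (hdet _ fun a b => ?_)
  by_cases ha : a = j
  · subst ha
    simp only [Matrix.updateRow_self]
    exact contDiffOn_const
  · simp only [Matrix.updateRow_ne ha]
    exact h.smooth a b

lemma IsLocalMetric.contDiffOn_christoffel (h : IsLocalMetric G U) (k i j : Fin n) :
    ContDiffOn ℝ ∞ (christoffel G k i j) U :=
  ContDiffOn.sum fun a _ => (h.contDiffOn_inv k a).mul (contDiffOn_const.mul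
    (((contDiffOn_pd i h.isOpen (h.smooth a j)).add (contDiffOn_pd j h.isOpen (h.smooth a i))).sub
      (contDiffOn_pd a h.isOpen (h.smooth i j))))

end Christoffel

/-! ### Riemannian metrics in a chart -/

section Riemannian

variable {n : ℕ} {M : Type*} [TopologicalSpace M] [ChartedSpace (Coord n) M]

lemma contDiffOn_dy (e : SmoothChart n M) (i : Fin n) {f : Coord n → Coord n → ℝ}
    (hf : ContDiffOn ℝ ∞ (fun p : Coord n × Coord n => f p.1 p.2) (slitDomain e)) :
    ContDiffOn ℝ ∞ (fun p : Coord n × Coord n => dy i f p.1 p.2) (slitDomain e) := by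
  have h : ContDiffOn ℝ ∞ (fun p : Coord n × Coord n =>
      fderiv ℝ (fun p : Coord n × Coord n => f p.1 p.2) p
        (0, EuclideanSpace.single i (1 : ℝ))) (slitDomain e) :=
    (hf.fderiv_of_isOpen (isOpen_slitDomain e) (m := ∞) (by simp)).clm_apply contDiffOn_const
  refine h.congr fun p hp => ?_
  have hd := (differentiableAt_of_contDiffOn (isOpen_slitDomain e) hf hp).hasFDerivAt
  have h2 : HasFDerivAt (fun y' => f p.1 y') _ p.2 :=
    HasFDerivAt.comp p.2 (f := fun y' => (p.1, y')) hd (hasFDerivAt_prodMk_right p.1 p.2)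
  rw [dy, h2.fderiv]
  simp

lemma contDiffOn_vertical (e : SmoothChart n M) {f : Coord n → Coord n → ℝ}
    (hf : ContDiffOn ℝ ∞ (fun p : Coord n × Coord n => f p.1 p.2) (slitDomain e)) {x : Coord n}
    (hx : x ∈ e.1.target) : ContDiffOn ℝ ∞ (f x) {0}ᶜ :=
  hf.comp (f := fun y => (x, y)) (contDiff_const.prodMk contDiff_id).contDiffOn
    fun _ hy => ⟨hx, hy⟩

/-- A nonzero vector. -/
def oneVec : Coord n := WithLp.toLp 2 fun _ => 1

lemma oneVec_ne_zero (hn : 0 < n) : (oneVec : Coord n) ≠ 0 := fun h => by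
  have := congrArg (fun v : Coord n => v ⟨0, hn⟩) h
  simp [oneVec] at this

/-- The matrix of the fundamental tensor of a Riemannian metric. -/
def metricMatrix (L : TangentBundle (𝓡 n) M → ℝ) (e : SmoothChart n M) (x : Coord n) :
    Matrix (Fin n) (Fin n) ℝ :=
  fundTensor L e x oneVec

variable [IsManifold (𝓡 n) ∞ M] {L : TangentBundle (𝓡 n) M → ℝ} (hL : IsRiemannian L)
  (hn : 0 < n) (e : SmoothChart n M) {x y : Coord n}

include hL hn

lemma fundTensor_eq_metricMatrix (hx : x ∈ e.1.target) (hy : y ≠ 0) :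
    fundTensor L e x y = metricMatrix L e x :=
  hL.isotropic e x y oneVec ⟨hx, hy⟩ ⟨hx, oneVec_ne_zero hn⟩

lemma isLocalMetric_metricMatrix : IsLocalMetric (metricMatrix L e) e.1.target where
  isOpen := e.1.open_target
  smooth i j := by
    have h := contDiffOn_dy e j (contDiffOn_dy e i (contDiffOn_localL hL.toIsPseudoFinsler e))
    exact contDiffOn_const.mul (h.comp (f := fun x => (x, oneVec))
      (contDiff_id.prodMk contDiff_const).contDiffOn fun _ hx => ⟨hx, oneVec_ne_zero hn⟩)
  posDef x hx := hL.posDef e x oneVec ⟨hx, oneVec_ne_zero hn⟩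

/-- Euler's theorem twice, for `L` of degree 2 and for its first vertical derivatives of degree 1;
by isotropy the resulting coefficients do not depend on `y`. -/
lemma localL_eq_quadratic (hx : x ∈ e.1.target) (hy : y ≠ 0) :
    localL L e x y = ∑ a, ∑ b, metricMatrix L e x a b * y a * y b := by
  have hs := contDiffOn_vertical e (contDiffOn_localL hL.toIsPseudoFinsler e) hx
  have hom : ∀ y : Coord n, y ≠ 0 → ∀ t : ℝ, 0 < t →
      localL L e x (t • y) = t ^ 2 * localL L e x y := fun y hy t ht =>
    localL_homogeneous hL.toIsPseudoFinsler e ⟨hx, hy⟩ ht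
  have h1 := euler_of_homogeneous (differentiableAt_of_contDiffOn isOpen_slit hs hy) (hom y hy)
  have h2 : ∀ a, ∑ b, y b * pd b (pd a (localL L e x)) y = (1 : ℕ) * pd a (localL L e x) y :=
    fun a => euler_of_homogeneous
      (differentiableAt_of_contDiffOn isOpen_slit (contDiffOn_pd a isOpen_slit hs) hy)
      fun t ht => pd_homogeneous a hs hom hy ht
  have h3 : ∀ a b, metricMatrix L e x a b = (1 / 2 : ℝ) * pd b (pd a (localL L e x)) y :=
    fun a b => by rw [← fundTensor_eq_metricMatrix hL hn e hx hy]; rfl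
  have h4 : ∀ a, ∑ b, metricMatrix L e x a b * y a * y b
      = (1 / 2 : ℝ) * (y a * pd a (localL L e x) y) := fun a => by
    have := h2 a
    rw [Nat.cast_one, one_mul] at this
    rw [← this, Finset.mul_sum, Finset.mul_sum]
    exact Finset.sum_congr rfl fun b _ => by rw [h3]; ring
  rw [Finset.sum_congr rfl fun a _ => h4 a, ← Finset.mul_sum, h1]
  push_cast
  ring

lemma dx_fundTensor (hx : x ∈ e.1.target) (hy : y ≠ 0) (c a b : Fin n) :
    dx c (fun x y => fundTensor L e x y a b) x y = pd c (fun x => metricMatrix L e x a b) x :=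
  pd_congr_of_eqOn c e.1.open_target
    (fun _ hz => congrFun₂ (fundTensor_eq_metricMatrix hL hn e hz hy) a b) hx

lemma dy_fundTensor (hx : x ∈ e.1.target) (hy : y ≠ 0) (c a b : Fin n) :
    dy c (fun x y => fundTensor L e x y a b) x y = 0 :=
  (pd_congr_of_eqOn c isOpen_slit
    (fun _ hz => congrFun₂ (fundTensor_eq_metricMatrix hL hn e hx hz) a b) hy).trans
    (pd_const c (metricMatrix L e x a b))

lemma meanCartan_eq_zero (hx : x ∈ e.1.target) (hy : y ≠ 0) (i : Fin n) :
    meanCartan L e i x y = 0 := by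
  simp [meanCartan, cartan, dy_fundTensor hL hn e hx hy]

lemma metricConnection_eq (hx : x ∈ e.1.target) (hy : y ≠ 0) (i k : Fin n) :
    metricConnection L e x y i k = ∑ b, christoffel (metricMatrix L e) k i b x * y b := by
  have hG := isLocalMetric_metricMatrix hL hn e
  have hsp : ∀ z ∈ ({0}ᶜ : Set (Coord n)), sprayCoeff L e k x z = ∑ b, ∑ c,
      (∑ a, (metricMatrix L e x)⁻¹ k a * ((1 / 4 : ℝ) *
        (2 * pd c (fun x => metricMatrix L e x a b) x
          - pd a (fun x => metricMatrix L e x b c) x))) * z b * z c := by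
    intro z hz
    simp only [sprayCoeff, dx_fundTensor hL hn e hx hz, fundTensor_eq_metricMatrix hL hn e hx hz,
      Finset.mul_sum, Finset.sum_mul]
    rw [Finset.sum_comm]
    refine Finset.sum_congr rfl fun b _ => ?_
    rw [Finset.sum_comm]
    exact Finset.sum_congr rfl fun c _ => Finset.sum_congr rfl fun a _ => by ring
  have hmem : (x, y) ∈ slitDomain e := ⟨hx, hy⟩
  rw [metricConnection, if_pos hmem]
  change pd i (sprayCoeff L e k x) y = _
  -- Differentiating the quadratic spray symmetrizes its coefficients in `i` and `b`, and this
  -- produces the Christoffel symbols.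
  rw [pd_congr_of_eqOn i isOpen_slit hsp hy, pd_quadratic]
  refine Finset.sum_congr rfl fun b _ => ?_
  congr 1
  rw [← Finset.sum_add_distrib]
  refine Finset.sum_congr rfl fun a _ => ?_
  rw [hG.pd_symm hx b i a]
  ring

lemma dy_metricConnection (hx : x ∈ e.1.target) (hy : y ≠ 0) (i j k : Fin n) :
    dy j (fun x y => metricConnection L e x y i k) x y
      = christoffel (metricMatrix L e) k i j x :=
  (pd_congr_of_eqOn j isOpen_slit
    (fun _ hz => metricConnection_eq hL hn e hx hz i k) hy).trans
    (pd_linear j fun b => christoffel (metricMatrix L e) k i b x)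

/-- The Berwald connection of a Riemannian metric is the Levi-Civita connection, which is compatible
with `g`; so the whole Landsberg tensor vanishes, before any trace is taken. -/
lemma meanLandsberg_eq_zero (hx : x ∈ e.1.target) (hy : y ≠ 0) (i : Fin n) :
    meanLandsberg L e i x y = 0 := by
  have hG := isLocalMetric_metricMatrix hL hn e
  have h : ∀ a b, landsberg L e a b i x y = 0 := by
    intro a b
    have h1 : ∑ c, christoffel (metricMatrix L e) c i a x * metricMatrix L e x c b
        = _ := Eq.trans (Finset.sum_congr rfl fun c _ => by rw [hG.symm hx c b, mul_comm])
          (hG.sum_mul_christoffel hx b i a)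
    have h2 : ∑ c, christoffel (metricMatrix L e) c i b x * metricMatrix L e x a c
        = _ := Eq.trans (Finset.sum_congr rfl fun c _ => by rw [mul_comm])
          (hG.sum_mul_christoffel hx a i b)
    simp only [landsberg, horizDeriv, dx_fundTensor hL hn e hx hy, dy_fundTensor hL hn e hx hy,
      berwald, dy_metricConnection hL hn e hx hy, fundTensor_eq_metricMatrix hL hn e hx hy, h1, h2]
    rw [hG.pd_symm hx b a i, hG.pd_symm hx i a b, hG.pd_symm hx b i a]
    simp
    ring
  simp [meanLandsberg, h]

end Riemannian
/-! ### Transformation law of the Christoffel symbols -/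

section Pullback

variable {n : ℕ}

lemma IsLocalMetric.mono {G : Coord n → Matrix (Fin n) (Fin n) ℝ} {U V : Set (Coord n)}
    (h : IsLocalMetric G U) (hV : IsOpen V) (hVU : V ⊆ U) : IsLocalMetric G V where
  isOpen := hV
  smooth i j := (h.smooth i j).mono hVU
  posDef x hx := h.posDef x (hVU hx)

lemma differentiableAt_of_coord {f : Coord n → Coord n} {z : Coord n}
    (hf : ∀ c, DifferentiableAt ℝ (fun z => f z c) z) : DifferentiableAt ℝ f z :=
  (differentiableAt_piLp 2).mpr hf

lemma pd_comp {F : Coord n → ℝ} {f : Coord n → Coord n} {z : Coord n} (i : Fin n)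
    (hF : DifferentiableAt ℝ F (f z)) (hf : ∀ c, DifferentiableAt ℝ (fun z => f z c) z) :
    pd i (fun z => F (f z)) z = ∑ c, pd c F (f z) * pd i (fun z => f z c) z := by
  have hf' := differentiableAt_of_coord hf
  have h := (hF.hasFDerivAt.comp z hf'.hasFDerivAt).fderiv
  have hc : ∀ c, pd i (fun z => f z c) z = fderiv ℝ f z (EuclideanSpace.single i 1) c := by
    intro c
    have := ((EuclideanSpace.proj c : Coord n →L[ℝ] ℝ).hasFDerivAt.comp z hf'.hasFDerivAt).fderiv
    change fderiv ℝ ((EuclideanSpace.proj c : Coord n →L[ℝ] ℝ) ∘ f) z _ = _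
    rw [this]
    rfl
  change fderiv ℝ (F ∘ f) z _ = _
  rw [h, ContinuousLinearMap.comp_apply, fderiv_eq_sum_pd]
  exact Finset.sum_congr rfl fun c _ => by rw [hc, mul_comm]

variable {G G' : Coord n → Matrix (Fin n) (Fin n) ℝ} {U V : Set (Coord n)} {ψ : Coord n → Coord n}
  {z : Coord n}

lemma pd_pullback (hG : IsLocalMetric G U) (hV : IsOpen V)
    (hψ : ∀ a, ContDiffOn ℝ ∞ (fun z => ψ z a) V) (hmaps : ∀ z ∈ V, ψ z ∈ U)
    (hpull : ∀ z ∈ V, ∀ i j, G' z i j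
      = ∑ a, ∑ b, pd i (fun z => ψ z a) z * pd j (fun z => ψ z b) z * G (ψ z) a b)
    (hz : z ∈ V) (k i j : Fin n) :
    pd k (fun z => G' z i j) z
      = ∑ a, ∑ b, pd k (pd i fun z => ψ z a) z * pd j (fun z => ψ z b) z * G (ψ z) a b
        + ∑ a, ∑ b, pd i (fun z => ψ z a) z * pd k (pd j fun z => ψ z b) z * G (ψ z) a b
        + ∑ a, ∑ b, ∑ c, pd i (fun z => ψ z a) z * pd j (fun z => ψ z b) z
          * pd k (fun z => ψ z c) z * pd c (fun x => G x a b) (ψ z) := by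
  have h1 : ∀ a, DifferentiableAt ℝ (fun z => ψ z a) z := fun a =>
    differentiableAt_of_contDiffOn hV (hψ a) hz
  have h2 : ∀ i a, DifferentiableAt ℝ (pd i fun z => ψ z a) z := fun i a =>
    differentiableAt_of_contDiffOn hV (contDiffOn_pd i hV (hψ a)) hz
  have h3 : ∀ a b, DifferentiableAt ℝ (fun x => G x a b) (ψ z) := fun a b =>
    differentiableAt_of_contDiffOn hG.isOpen (hG.smooth a b) (hmaps z hz)
  have h4 : ∀ a b, DifferentiableAt ℝ (fun z => G (ψ z) a b) z := fun a b =>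
    (h3 a b).comp z (differentiableAt_of_coord h1)
  have h5 : ∀ a b, DifferentiableAt ℝ (fun z => pd i (fun z => ψ z a) z *
      pd j (fun z => ψ z b) z * G (ψ z) a b) z := fun a b =>
    ((h2 i a).fun_mul (h2 j b)).fun_mul (h4 a b)
  rw [pd_congr_of_eqOn k hV (fun w hw => hpull w hw i j) hz,
    pd_sum _ _ fun a _ => DifferentiableAt.fun_sum fun b _ => h5 a b,
    ← Finset.sum_add_distrib, ← Finset.sum_add_distrib]
  refine Finset.sum_congr rfl fun a _ => ?_
  rw [pd_sum _ _ fun b _ => h5 a b, ← Finset.sum_add_distrib, ← Finset.sum_add_distrib]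
  refine Finset.sum_congr rfl fun b _ => ?_
  rw [pd_mul _ ((h2 i a).fun_mul (h2 j b)) (h4 a b), pd_mul _ (h2 i a) (h2 j b),
    pd_comp (F := fun x => G x a b) k (h3 a b) h1, Finset.mul_sum]
  have : ∀ c, pd i (fun z => ψ z a) z * pd j (fun z => ψ z b) z *
      (pd c (fun x => G x a b) (ψ z) * pd k (fun z => ψ z c) z)
      = pd i (fun z => ψ z a) z * pd j (fun z => ψ z b) z
          * pd k (fun z => ψ z c) z * pd c (fun x => G x a b) (ψ z) := fun c => by ring
  rw [Finset.sum_congr rfl fun c _ => this c]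
  ring

/-- Both sides are lowered with `G` and contracted with the Jacobian `P`. The left side becomes the
lowered Christoffel symbol of `G'`, which `pd_pullback` expands; the two operations are injective,
so they can be undone. -/
theorem christoffel_pullback (hG : IsLocalMetric G U) (hG' : IsLocalMetric G' V)
    (hψ : ∀ a, ContDiffOn ℝ ∞ (fun z => ψ z a) V) (hmaps : ∀ z ∈ V, ψ z ∈ U)
    (hpull : ∀ z ∈ V, ∀ i j, G' z i j
      = ∑ a, ∑ b, pd i (fun z => ψ z a) z * pd j (fun z => ψ z b) z * G (ψ z) a b)
    (hz : z ∈ V) (a i j : Fin n) :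
    ∑ k, pd k (fun z => ψ z a) z * christoffel G' k i j z
      = pd i (pd j fun z => ψ z a) z + ∑ b, ∑ c, christoffel G a b c (ψ z)
        * pd i (fun z => ψ z b) z * pd j (fun z => ψ z c) z := by
  have hU := hmaps z hz
  set P : Fin n → Fin n → ℝ := fun a i => pd i (fun z => ψ z a) z with hP
  set Q : Fin n → Fin n → Fin n → ℝ := fun a i j => pd i (pd j fun z => ψ z a) z with hQ
  set dG : Fin n → Fin n → Fin n → ℝ := fun c a b => pd c (fun x => G x a b) (ψ z) with hdG
  have hQs : ∀ a i j, Q a i j = Q a j i := fun a i j => pd_comm i j hG'.isOpen (hψ a) hz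
  have hder := pd_pullback hG hG'.isOpen hψ hmaps hpull hz
  have hp := hpull z hz
  change ∑ k, P a k * christoffel G' k i j z
    = Q a i j + ∑ b, ∑ c, christoffel G a b c (ψ z) * P b i * P c j
  have hPG : ∀ l, ∑ b, P b l * ∑ a, G (ψ z) b a * ∑ k, P a k * christoffel G' k i j z
      = ∑ b, P b l * ∑ a, G (ψ z) b a * (Q a i j
        + ∑ b, ∑ c, christoffel G a b c (ψ z) * P b i * P c j) := by
    intro l
    have hL : ∑ b, P b l * ∑ a, G (ψ z) b a * ∑ k, P a k * christoffel G' k i j z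
        = ∑ k, G' z l k * christoffel G' k i j z := by
      simp only [hp, Finset.mul_sum, Finset.sum_mul]
      rw [Finset.sum_comm' (t' := Finset.univ) (s' := fun _ => Finset.univ) (by simp)]
      rw [Finset.sum_comm]
      conv_lhs => enter [2, b]; rw [Finset.sum_comm]
      rw [Finset.sum_comm]
      refine Finset.sum_congr rfl fun k _ => Finset.sum_congr rfl fun b _ =>
        Finset.sum_congr rfl fun a _ => ?_
      ring
    have hR : ∀ b, ∑ a, G (ψ z) b a * ∑ c, ∑ d, christoffel G a c d (ψ z) * P c i * P d j
        = ∑ c, ∑ d, (1 / 2 : ℝ) * (dG c b d + dG d b c - dG b c d) * P c i * P d j := by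
      intro b
      simp only [hdG, ← hG.sum_mul_christoffel hU, Finset.mul_sum, Finset.sum_mul]
      rw [Finset.sum_comm]
      refine Finset.sum_congr rfl fun c _ => ?_
      rw [Finset.sum_comm]
      refine Finset.sum_congr rfl fun d _ => Finset.sum_congr rfl fun a _ => ?_
      ring
    rw [hL, hG'.sum_mul_christoffel hz, hder i l j, hder j l i, hder l i j]
    change (1 / 2 : ℝ) * (∑ a, ∑ b, Q a i l * P b j * G (ψ z) a b
        + ∑ a, ∑ b, P a l * Q b i j * G (ψ z) a b
        + ∑ a, ∑ b, ∑ c, P a l * P b j * P c i * dG c a b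
      + (∑ a, ∑ b, Q a j l * P b i * G (ψ z) a b
        + ∑ a, ∑ b, P a l * Q b j i * G (ψ z) a b
        + ∑ a, ∑ b, ∑ c, P a l * P b i * P c j * dG c a b)
      - (∑ a, ∑ b, Q a l i * P b j * G (ψ z) a b
        + ∑ a, ∑ b, P a i * Q b l j * G (ψ z) a b
        + ∑ a, ∑ b, ∑ c, P a i * P b j * P c l * dG c a b)) = _
    -- Of the six second-derivative terms, four cancel in pairs (`s1`, `s2`) and the other two agree
    -- (`s3`), which absorbs the factor `1/2`. The terms in `dG` match after renaming indices (`s4`,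
    -- `s5`).
    have s1 : ∑ a, ∑ b, Q a i l * P b j * G (ψ z) a b
        = ∑ a, ∑ b, Q a l i * P b j * G (ψ z) a b := by simp only [hQs _ i l]
    have s2 : ∑ a, ∑ b, Q a j l * P b i * G (ψ z) a b
        = ∑ a, ∑ b, P a i * Q b l j * G (ψ z) a b := by
      rw [Finset.sum_comm]
      refine Finset.sum_congr rfl fun a _ => Finset.sum_congr rfl fun b _ => ?_
      rw [hQs b j l, hG.symm hU a b]; ring
    have s3 : ∑ a, ∑ b, P a l * Q b j i * G (ψ z) a b
        = ∑ a, ∑ b, P a l * Q b i j * G (ψ z) a b := by simp only [hQs _ j i]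
    have s4 : ∑ a, ∑ b, ∑ c, P a l * P b j * P c i * dG c a b
        = ∑ a, ∑ b, ∑ c, P a l * P b i * P c j * dG b a c := by
      refine Finset.sum_congr rfl fun a _ => ?_
      rw [Finset.sum_comm]
      refine Finset.sum_congr rfl fun b _ => Finset.sum_congr rfl fun c _ => ?_
      ring
    have s5 : ∑ a, ∑ b, ∑ c, P a i * P b j * P c l * dG c a b
        = ∑ a, ∑ b, ∑ c, P a l * P b i * P c j * dG a b c := by
      conv_lhs => enter [2, a]; rw [Finset.sum_comm]
      rw [Finset.sum_comm]
      refine Finset.sum_congr rfl fun a _ => Finset.sum_congr rfl fun b _ =>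
        Finset.sum_congr rfl fun c _ => ?_
      ring
    have s6 : ∑ b, P b l * ∑ a, G (ψ z) b a * (Q a i j
        + ∑ b, ∑ c, christoffel G a b c (ψ z) * P b i * P c j)
        = ∑ a, ∑ b, P a l * Q b i j * G (ψ z) a b
          + (1 / 2 : ℝ) * (∑ a, ∑ b, ∑ c, P a l * P b i * P c j * dG b a c
            + ∑ a, ∑ b, ∑ c, P a l * P b i * P c j * dG c a b
            - ∑ a, ∑ b, ∑ c, P a l * P b i * P c j * dG a b c) := by
      simp only [mul_add, Finset.sum_add_distrib, hR]
      simp only [← Finset.sum_add_distrib, ← Finset.sum_sub_distrib, Finset.mul_sum]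
      refine Finset.sum_congr rfl fun a _ => Finset.sum_congr rfl fun b _ => ?_
      congr 1
      · ring
      · exact Finset.sum_congr rfl fun c _ => by ring
    rw [s1, s2, s3, s4, s5, s6]
    ring
  -- The Jacobian is invertible because `G' = Pᵀ G P` is non-degenerate.
  have hPdet : IsUnit (Matrix.of P)ᵀ.det := by
    have hm : G' z = (Matrix.of P)ᵀ * (G (ψ z) * Matrix.of P) := by
      ext l k
      simp only [hp, Matrix.mul_apply, Matrix.transpose_apply, Matrix.of_apply, Finset.mul_sum]
      refine Finset.sum_congr rfl fun a _ => Finset.sum_congr rfl fun b _ => ?_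
      ring
    have h := hG'.isUnit_det hz
    rw [hm, Matrix.det_mul] at h
    exact isUnit_of_mul_isUnit_left h
  have hinj := Matrix.mulVec_injective_of_isUnit
    ((Matrix.isUnit_iff_isUnit_det _).mpr hPdet)
  have h1 := hinj (funext hPG : (Matrix.of P)ᵀ *ᵥ _ = (Matrix.of P)ᵀ *ᵥ _)
  exact congrFun (hG.cancel hU fun l => congrFun h1 l) a

end Pullback
/-! ### Changes of charts -/

section Transition

variable {n : ℕ} {M : Type*} [TopologicalSpace M] [ChartedSpace (Coord n) M]

/-- The domain of the change of coordinates from `e` to `e'`. -/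
def overlap (e e' : SmoothChart n M) : Set (Coord n) :=
  e.1.target ∩ e.1.symm ⁻¹' e'.1.source

variable (e e' : SmoothChart n M) {x z : Coord n}

lemma isOpen_overlap : IsOpen (overlap e e') :=
  e.1.symm.continuousOn.isOpen_inter_preimage e.1.open_target e'.1.open_source

variable {e e'}

lemma transition_mem (hx : x ∈ overlap e e') : transition e e' x ∈ overlap e' e := by
  refine ⟨e'.1.map_source hx.2, ?_⟩
  rw [Set.mem_preimage, transition, e'.1.left_inv hx.2]
  exact e.1.map_target hx.1

lemma transition_transition (hx : x ∈ overlap e e') :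
    transition e' e (transition e e' x) = x := by
  rw [transition, transition, e'.1.left_inv hx.2, e.1.right_inv hx.1]

variable (e e')

lemma contDiffOn_transition : ContDiffOn ℝ ∞ (transition e e') (overlap e e') := by
  rw [← contMDiffOn_iff_contDiffOn]
  exact (contMDiffOn_of_mem_maximalAtlas e'.2).comp
    ((contMDiffOn_symm_of_mem_maximalAtlas e.2).mono Set.inter_subset_left) fun _ hx => hx.2

lemma contDiffOn_transition_coord (k : Fin n) :
    ContDiffOn ℝ ∞ (fun x => transition e e' x k) (overlap e e') :=
  (contDiff_coord k).comp_contDiffOn (contDiffOn_transition e e')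

variable {e e'}

lemma sum_dTrans_mul_dTrans (hx : x ∈ overlap e e') (a b : Fin n) :
    ∑ c, dTrans e' e a c (transition e e' x) * dTrans e e' c b x = if a = b then 1 else 0 := by
  have h := pd_comp (F := fun z => transition e' e z a) (f := transition e e') b
    (differentiableAt_of_contDiffOn (isOpen_overlap e' e) (contDiffOn_transition_coord e' e a)
      (transition_mem hx))
    fun c => differentiableAt_of_contDiffOn (isOpen_overlap e e')
      (contDiffOn_transition_coord e e' c) hx
  refine h.symm.trans ?_
  rw [pd_congr_of_eqOn (H := fun z => z a) b (isOpen_overlap e e')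
    (fun w hw => by rw [transition_transition hw]) hx, pd_coord]
  simp [eq_comm]

lemma fderiv_transition_apply (hz : z ∈ overlap e' e) (w : Coord n) (a : Fin n) :
    fderiv ℝ (transition e' e) z w a = ∑ i, dTrans e' e a i z * w i := by
  have hd := differentiableAt_of_contDiffOn (isOpen_overlap e' e) (contDiffOn_transition e' e) hz
  have h := ((EuclideanSpace.proj a : Coord n →L[ℝ] ℝ).hasFDerivAt.comp z hd.hasFDerivAt).fderiv
  have h2 := fderiv_eq_sum_pd (fun z => transition e' e z a) z w
  change fderiv ℝ ((EuclideanSpace.proj a : Coord n →L[ℝ] ℝ) ∘ transition e' e) z w = _ at h2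
  rw [h] at h2
  exact h2.trans (Finset.sum_congr rfl fun i _ => mul_comm _ _)

lemma tangentBundle_mk_congr {p q : M} {v w : Coord n} (hpq : p = q) (hvw : v = w) :
    (⟨p, v⟩ : TangentBundle (𝓡 n) M) = ⟨q, w⟩ := by
  subst hpq hvw
  rfl

lemma tangentVec_transition (hz : z ∈ overlap e' e) (w : Coord n) :
    tangentVec e' z w = tangentVec e (transition e' e z) (fderiv ℝ (transition e' e) z w) := by
  have hd := differentiableAt_of_contDiffOn (isOpen_overlap e' e) (contDiffOn_transition e' e) hz
  have hev : e'.1.symm =ᶠ[𝓝 z] e.1.symm ∘ transition e' e := by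
    filter_upwards [(isOpen_overlap e' e).mem_nhds hz] with y hy
    exact (e.1.left_inv hy.2).symm
  have hcomp := mfderiv_comp z
    (e.mdifferentiable.mdifferentiableAt_symm (transition_mem hz).1) hd.mdifferentiableAt
  refine tangentBundle_mk_congr (e.1.left_inv hz.2).symm ?_
  have h := hev.mfderiv_eq (I := 𝓡 n) (I' := 𝓡 n)
  rw [hcomp, mfderiv_eq_fderiv] at h
  exact congrArg (fun T : Coord n →L[ℝ] Coord n => T w) h

lemma localL_transition (L : TangentBundle (𝓡 n) M → ℝ) (hz : z ∈ overlap e' e) (w : Coord n) :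
    localL L e' z w
      = localL L e (transition e' e z) (fderiv ℝ (transition e' e) z w) := by
  rw [localL, tangentVec_transition hz, localL]

lemma fderiv_transition_ne_zero (hz : z ∈ overlap e' e) {w : Coord n} (hw : w ≠ 0) :
    fderiv ℝ (transition e' e) z w ≠ 0 := by
  intro h
  apply hw
  ext b
  have h1 := fun a => fderiv_transition_apply hz w a
  simp only [h, PiLp.zero_apply] at h1
  have h2 : ∑ c, dTrans e e' b c (transition e' e z) * ∑ i, dTrans e' e c i z * w i = w b := by
    simp only [Finset.mul_sum, ← mul_assoc]
    rw [Finset.sum_comm]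
    simp only [← Finset.sum_mul, sum_dTrans_mul_dTrans hz]
    simp
  rw [← h2]
  simp [← h1]

/-- Polarization by two derivatives. The forms are only compared off the origin, so the derivatives
are evaluated at the nonzero vector `oneVec`. -/
lemma quadratic_coeff_eq (hn : 0 < n) {c d : Fin n → Fin n → ℝ}
    (h : ∀ y : Coord n, y ≠ 0 → ∑ a, ∑ b, c a b * y a * y b = ∑ a, ∑ b, d a b * y a * y b)
    (i j : Fin n) : c i j + c j i = d i j + d j i := by
  have h1 : ∀ y ∈ ({0}ᶜ : Set (Coord n)),
      ∑ b, (c i b + c b i) * y b = ∑ b, (d i b + d b i) * y b := by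
    intro y hy
    rw [← pd_quadratic, ← pd_quadratic]
    exact pd_congr_of_eqOn i isOpen_slit h hy
  have h2 := pd_congr_of_eqOn j isOpen_slit h1 (oneVec_ne_zero hn)
  rwa [pd_linear, pd_linear] at h2

variable [IsManifold (𝓡 n) ∞ M] {L : TangentBundle (𝓡 n) M → ℝ}

/-- `L` is a function on the tangent bundle, so its expressions in two charts are the same quadratic
form up to the Jacobian; symmetric coefficients of equal forms agree. -/
lemma metricMatrix_transition (hL : IsRiemannian L) (hn : 0 < n) (hz : z ∈ overlap e' e)
    (i j : Fin n) :
    metricMatrix L e' z i j = ∑ a, ∑ b, dTrans e' e a i z * dTrans e' e b j z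
      * metricMatrix L e (transition e' e z) a b := by
  have hU := (transition_mem hz).1
  have hG := isLocalMetric_metricMatrix hL hn e
  have hG' := isLocalMetric_metricMatrix hL hn e'
  set R : Fin n → Fin n → ℝ := fun i j => ∑ a, ∑ b, dTrans e' e a i z * dTrans e' e b j z
      * metricMatrix L e (transition e' e z) a b with hR
  have hq : ∀ y : Coord n, y ≠ 0 → ∑ i, ∑ j, metricMatrix L e' z i j * y i * y j
      = ∑ i, ∑ j, R i j * y i * y j := by
    intro y hy
    rw [← localL_eq_quadratic hL hn e' hz.1 hy, localL_transition L hz,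
      localL_eq_quadratic hL hn e hU (fderiv_transition_ne_zero hz hy)]
    simp only [hR, fderiv_transition_apply hz, Finset.mul_sum, Finset.sum_mul]
    calc _ = ∑ a, ∑ b, ∑ i, ∑ j, dTrans e' e a i z * dTrans e' e b j z
          * metricMatrix L e (transition e' e z) a b * y i * y j := by
          refine Finset.sum_congr rfl fun a _ => Finset.sum_congr rfl fun b _ => ?_
          rw [Finset.sum_comm]
          exact Finset.sum_congr rfl fun i _ => Finset.sum_congr rfl fun j _ => by ring
      _ = ∑ a, ∑ i, ∑ j, ∑ b, dTrans e' e a i z * dTrans e' e b j z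
          * metricMatrix L e (transition e' e z) a b * y i * y j := by
          refine Finset.sum_congr rfl fun a _ => ?_
          rw [Finset.sum_comm]
          exact Finset.sum_congr rfl fun i _ => Finset.sum_comm
      _ = _ := by
          rw [Finset.sum_comm]
          exact Finset.sum_congr rfl fun i _ => Finset.sum_comm
  have h := quadratic_coeff_eq hn hq i j
  have hsymm : R j i = R i j := by
    simp only [hR]
    rw [Finset.sum_comm]
    refine Finset.sum_congr rfl fun a _ => Finset.sum_congr rfl fun b _ => ?_
    rw [hG.symm hU b a]; ring
  rw [hsymm, hG'.symm hz.1 j i] at h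
  linarith

lemma christoffel_transition (hL : IsRiemannian L) (hn : 0 < n) (hz : z ∈ overlap e' e)
    (a i j : Fin n) :
    ∑ k, dTrans e' e a k z * christoffel (metricMatrix L e') k i j z
      = ddTrans e' e a i j z + ∑ b, ∑ c, christoffel (metricMatrix L e) a b c (transition e' e z)
        * dTrans e' e b i z * dTrans e' e c j z :=
  christoffel_pullback (isLocalMetric_metricMatrix hL hn e)
    ((isLocalMetric_metricMatrix hL hn e').mono (isOpen_overlap e' e) Set.inter_subset_left)
    (contDiffOn_transition_coord e' e) (fun _ hw => (transition_mem hw).1)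
    (fun _ hw => metricMatrix_transition hL hn hw) hz a i j

/-! ### The metric connection is a symmetric solution -/

lemma isNonlinearConnection_metricConnection (hL : IsRiemannian L) (hn : 0 < n) :
    IsNonlinearConnection (metricConnection L) where
  smooth e i k := by
    have hG := isLocalMetric_metricMatrix hL hn e
    have h : ContDiffOn ℝ ∞ (fun p : Coord n × Coord n =>
        ∑ b, christoffel (metricMatrix L e) k i b p.1 * p.2 b) (slitDomain e) :=
      ContDiffOn.sum fun b _ => ((hG.contDiffOn_christoffel k i b).comp
        contDiff_fst.contDiffOn fun p hp => hp.1).mul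
          ((contDiff_coord b).comp contDiff_snd).contDiffOn
    exact h.congr fun p hp => metricConnection_eq hL hn e hp.1 hp.2 i k
  homogeneous e x y h t ht i k := by
    rw [metricConnection_eq hL hn e h.1 h.2,
      metricConnection_eq hL hn e h.1 (smul_ne_zero ht.ne' h.2), Finset.mul_sum]
    refine Finset.sum_congr rfl fun b _ => ?_
    rw [PiLp.smul_apply, smul_eq_mul]
    ring
  cocycle e e' x y x' y' h hx hx' hy' i k := by
    have hov : x ∈ overlap e e' := ⟨h.1, hx⟩
    have hov' : x' ∈ overlap e' e := hx' ▸ transition_mem hov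
    have hxx' : transition e' e x' = x := by rw [hx', transition_transition hov]
    have hyy' : ∀ d, y d = ∑ b, dTrans e' e d b x' * y' b := by
      intro d
      simp only [hy', Finset.mul_sum, ← mul_assoc]
      rw [Finset.sum_comm]
      simp only [← Finset.sum_mul, hx', sum_dTrans_mul_dTrans hov]
      simp
    have hy0 : y' ≠ 0 := by
      intro h0
      apply h.2
      ext d
      simp [hyy', h0]
    -- This is `christoffel_transition` contracted with `y'`. The cocycle law follows on multiplying
    -- by the inverse Jacobian (`hinv`).
    have key : ∀ c, ∑ b, ddTrans e' e c i b x' * y' b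
        + ∑ a, dTrans e' e a i x' * metricConnection L e x y a c
        = ∑ m, dTrans e' e c m x' * metricConnection L e' x' y' i m := by
      intro c
      have h1 : ∀ b, ddTrans e' e c i b x' = _ := fun b =>
        eq_sub_of_add_eq (christoffel_transition hL hn hov' c i b).symm
      simp only [metricConnection_eq hL hn e h.1 h.2, metricConnection_eq hL hn e' hov'.1 hy0, h1,
        hxx', sub_mul, Finset.sum_sub_distrib]
      have h2 : ∑ b, (∑ k, dTrans e' e c k x' * christoffel (metricMatrix L e') k i b x') * y' b
          = ∑ m, dTrans e' e c m x' * ∑ b, christoffel (metricMatrix L e') m i b x' * y' b := by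
        simp only [Finset.sum_mul, Finset.mul_sum]
        rw [Finset.sum_comm]
        exact Finset.sum_congr rfl fun m _ => Finset.sum_congr rfl fun b _ => by ring
      have h3 : ∑ b, (∑ a, ∑ d, christoffel (metricMatrix L e) c a d x * dTrans e' e a i x'
            * dTrans e' e d b x') * y' b
          = ∑ a, dTrans e' e a i x' * ∑ d, christoffel (metricMatrix L e) c a d x * y d := by
        simp only [hyy', Finset.sum_mul, Finset.mul_sum]
        rw [Finset.sum_comm]
        refine Finset.sum_congr rfl fun a _ => ?_
        rw [Finset.sum_comm]
        exact Finset.sum_congr rfl fun d _ => Finset.sum_congr rfl fun b _ => by ring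
      rw [h2, h3]
      ring
    have hinv : ∀ m, ∑ c, dTrans e e' k c x * dTrans e' e c m x' = if k = m then 1 else 0 := by
      intro m
      have := sum_dTrans_mul_dTrans hov' k m
      rwa [hxx'] at this
    calc metricConnection L e' x' y' i k
        = ∑ m, (if k = m then 1 else 0) * metricConnection L e' x' y' i m := by simp
      _ = ∑ c, dTrans e e' k c x * ∑ m, dTrans e' e c m x' * metricConnection L e' x' y' i m := by
          simp only [← hinv, Finset.sum_mul, Finset.mul_sum]
          rw [Finset.sum_comm]
          exact Finset.sum_congr rfl fun m _ => Finset.sum_congr rfl fun c _ => by ring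
      _ = _ := by
          simp only [← key, mul_add, Finset.sum_add_distrib, Finset.mul_sum, mul_assoc]
  off_domain e x y h i k := if_neg h

lemma isSymmetric_metricConnection (hL : IsRiemannian L) (hn : 0 < n) :
    IsSymmetric (metricConnection L) := fun e x y h i j k => by
  rw [dy_metricConnection hL hn e h.1 h.2, dy_metricConnection hL hn e h.1 h.2,
    (isLocalMetric_metricMatrix hL hn e).christoffel_symm h.1, sub_self]

lemma solvesAffineEquation_metricConnection (hL : IsRiemannian L) (hn : 0 < n) :
    SolvesAffineEquation L (metricConnection L) := by
  intro e x y h i j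
  have hJ : ∀ i k, diffTensor L (metricConnection L) e i k = fun _ _ => 0 := by
    intro i k
    funext x y
    exact sub_self _
  have hdy : ∀ a, dy a (fun _ _ : Coord n => (0 : ℝ)) x y = 0 := fun a => pd_const a 0
  simp [affineCovector, hJ, hdy, meanLandsberg_eq_zero hL hn e h.1 h.2]

end Transition
/-! ### Uniqueness -/

section Uniqueness

variable {n : ℕ}

/-- The fibrewise form of the uniqueness statement. -/
theorem eq_zero_of_symmetric_of_trace_eq (hn : 3 ≤ n) {G : Matrix (Fin n) (Fin n) ℝ}
    (hG : G.PosDef) {J : Fin n → Fin n → Coord n → ℝ}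
    (smooth : ∀ i k, ContDiffOn ℝ ∞ (J i k) {0}ᶜ)
    (hom : ∀ i k, ∀ y : Coord n, y ≠ 0 → ∀ t : ℝ, 0 < t → J i k (t • y) = t * J i k y)
    (symm : ∀ y : Coord n, y ≠ 0 → ∀ i j k, pd j (J i k) y = pd i (J j k) y)
    (heq : ∀ y : Coord n, y ≠ 0 → ∀ b,
      ((n : ℝ) + 2) * ∑ a, (∑ c, G a c * y c) / (∑ a, ∑ b, G a b * y a * y b) * J b a y
        = 2 * ∑ a, pd b (J a a) y)
    {y : Coord n} (hy : y ≠ 0) (i k : Fin n) : J i k y = 0 := by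
  have hGs : ∀ a b, G a b = G b a := fun a b => by simpa using hG.isHermitian.apply b a
  have hGu : IsUnit G.det := isUnit_iff_ne_zero.mpr hG.det_pos.ne'
  have hn2 : (n : ℝ) + 2 ≠ 0 := by positivity
  set q : Coord n → ℝ := fun y => ∑ a, ∑ b, G a b * y a * y b with hq
  set yl : Fin n → Coord n → ℝ := fun a y => ∑ c, G a c * y c with hyl
  set D : Coord n → ℝ := fun y => ∑ a, J a a y with hD
  -- The factor `1/2` makes the 2-homogeneous `Z k` a potential of `J · k`: see `pZ`, where symmetry
  -- turns `y^a ∂_i J_a^k` into `y^a ∂_a J_i^k = J_i^k`.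
  set Z : Fin n → Coord n → ℝ := fun k y => (1 / 2 : ℝ) * ∑ a, J a k y * y a with hZ
  have hqpos : ∀ y : Coord n, y ≠ 0 → q y ≠ 0 := by
    intro y hy
    have hy' : (fun a => y a) ≠ 0 := fun h => hy (by ext a; exact congrFun h a)
    have h := hG.dotProduct_mulVec_pos hy'
    have h2 : star (fun a => y a) ⬝ᵥ (G *ᵥ fun a => y a) = q y := by
      simp only [hq, dotProduct, Matrix.mulVec, Finset.mul_sum, Pi.star_apply, star_trivial]
      exact Finset.sum_congr rfl fun a _ => Finset.sum_congr rfl fun b _ => by ring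
    rw [h2] at h
    exact h.ne'
  have dJ : ∀ i k, ∀ y : Coord n, y ≠ 0 → DifferentiableAt ℝ (J i k) y := fun i k y hy =>
    differentiableAt_of_contDiffOn isOpen_slit (smooth i k) hy
  have sD : ContDiffOn ℝ ∞ D {0}ᶜ := ContDiffOn.sum fun a _ => smooth a a
  have sZ : ∀ k, ContDiffOn ℝ ∞ (Z k) {0}ᶜ := fun k => contDiffOn_const.mul
    (ContDiffOn.sum fun a _ => (smooth a k).mul (contDiff_coord a).contDiffOn)
  have dD : ∀ y : Coord n, y ≠ 0 → DifferentiableAt ℝ D y := fun y hy =>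
    differentiableAt_of_contDiffOn isOpen_slit sD hy
  have ddD : ∀ b, ∀ y : Coord n, y ≠ 0 → DifferentiableAt ℝ (pd b D) y := fun b y hy =>
    differentiableAt_of_contDiffOn isOpen_slit (contDiffOn_pd b isOpen_slit sD) hy
  have dZ : ∀ k, ∀ y : Coord n, y ≠ 0 → DifferentiableAt ℝ (Z k) y := fun k y hy =>
    differentiableAt_of_contDiffOn isOpen_slit (sZ k) hy
  have dyl : ∀ a, ∀ y : Coord n, DifferentiableAt ℝ (yl a) y := fun a y =>
    DifferentiableAt.fun_sum fun c _ => (differentiableAt_coord c).const_mul _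
  have dq : ∀ y : Coord n, DifferentiableAt ℝ q y := fun y =>
    DifferentiableAt.fun_sum fun a _ => DifferentiableAt.fun_sum fun b _ =>
      ((differentiableAt_coord a).const_mul _).fun_mul (differentiableAt_coord b)
  have pq : ∀ b, ∀ y : Coord n, pd b q y = 2 * yl b y := by
    intro b y
    refine (pd_quadratic b fun a c => G a c).trans ?_
    rw [hyl, Finset.mul_sum]
    exact Finset.sum_congr rfl fun c _ => by rw [hGs c b]; ring
  have homD : ∀ y : Coord n, y ≠ 0 → ∀ t : ℝ, 0 < t → D (t • y) = t * D y := by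
    intro y hy t ht
    simp only [hD, hom _ _ y hy t ht, Finset.mul_sum]
  have eJ : ∀ i k, ∀ y : Coord n, y ≠ 0 → ∑ a, y a * pd a (J i k) y = J i k y := by
    intro i k y hy
    simpa using euler_of_homogeneous (k := 1) (dJ i k y hy)
      fun t ht => by simpa using hom i k y hy t ht
  have eD : ∀ y : Coord n, y ≠ 0 → ∑ a, y a * pd a D y = D y := by
    intro y hy
    simpa using euler_of_homogeneous (k := 1) (dD y hy)
      fun t ht => by simpa using homD y hy t ht
  have pZ : ∀ i k, ∀ y : Coord n, y ≠ 0 → pd i (Z k) y = J i k y := by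
    intro i k y hy
    rw [hZ]
    have hd : ∀ a, DifferentiableAt ℝ (fun y : Coord n => J a k y * y a) y := fun a =>
      (dJ a k y hy).fun_mul (differentiableAt_coord a)
    rw [pd_const_mul _ _ (DifferentiableAt.fun_sum fun a _ => hd a), pd_sum _ _ fun a _ => hd a]
    have : ∀ a, pd i (fun y : Coord n => J a k y * y a) y
        = J a k y * (if i = a then 1 else 0) + y a * pd a (J i k) y := fun a => by
      rw [pd_mul _ (dJ a k y hy) (differentiableAt_coord a), pd_coord, symm y hy a i k]; ring
    simp only [this, Finset.sum_add_distrib, eJ i k y hy]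
    simp
    ring
  have e1 : ∀ y : Coord n, y ≠ 0 → ∀ b, ((n : ℝ) + 2) * ∑ a, yl a y * J b a y
      = 2 * q y * pd b D y := by
    intro y hy b
    have h1 : pd b D y = ∑ a, pd b (J a a) y := pd_sum _ _ fun a _ => dJ a a y hy
    have h2 := heq y hy b
    rw [← h1] at h2
    have h3 : ∑ a, yl a y * J b a y = q y * ∑ a, yl a y / q y * J b a y := by
      rw [Finset.mul_sum]
      refine Finset.sum_congr rfl fun a _ => ?_
      have := hqpos y hy
      field_simp
    rw [h3]
    linear_combination q y * h2
  -- Contraction of `e1` with `y^b`.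
  have e2 : ∀ y : Coord n, y ≠ 0 → ((n : ℝ) + 2) * ∑ a, yl a y * Z a y = q y * D y := by
    intro y hy
    have h1 : ∑ b, y b * (((n : ℝ) + 2) * ∑ a, yl a y * J b a y)
        = 2 * (((n : ℝ) + 2) * ∑ a, yl a y * Z a y) := by
      simp only [hZ, Finset.mul_sum]
      rw [Finset.sum_comm]
      exact Finset.sum_congr rfl fun a _ => Finset.sum_congr rfl fun b _ => by ring
    have h2 : ∑ b, y b * (2 * q y * pd b D y) = 2 * (q y * D y) := by
      rw [← eD y hy, Finset.mul_sum, Finset.mul_sum]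
      exact Finset.sum_congr rfl fun b _ => by ring
    rw [Finset.sum_congr rfl fun b _ => by rw [e1 y hy b], h2] at h1
    linarith
  -- Derivative of `e2` minus `e1`: the terms `y_a J_b^a` cancel, so `Z` is expressed through `D`
  -- alone.
  have e3 : ∀ y : Coord n, y ≠ 0 → ∀ b, ((n : ℝ) + 2) * ∑ a, G b a * Z a y
      = 2 * yl b y * D y - q y * pd b D y := by
    intro y hy b
    have hd : ∀ a, DifferentiableAt ℝ (fun y => yl a y * Z a y) y := fun a =>
      (dyl a y).fun_mul (dZ a y hy)
    have h1 := pd_congr_of_eqOn b isOpen_slit e2 hy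
    rw [pd_const_mul _ _ (DifferentiableAt.fun_sum fun a _ => hd a), pd_sum _ _ fun a _ => hd a,
      pd_mul _ (dq y) (dD y hy), pq] at h1
    have h2 : ∀ a, pd b (fun y => yl a y * Z a y) y = yl a y * J b a y + G b a * Z a y := by
      intro a
      rw [pd_mul _ (dyl a y) (dZ a y hy), pZ b a y hy, hGs b a]
      congr 2
      exact pd_linear b fun c => G a c
    rw [Finset.sum_congr rfl fun a _ => h2 a, Finset.sum_add_distrib] at h1
    linear_combination h1 - e1 y hy b
  have inv_lower : ∀ (v : Fin n → ℝ) (k : Fin n), ∑ b, G⁻¹ k b * ∑ a, G b a * v a = v k := by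
    intro v k
    have := congrFun (Matrix.mulVec_mulVec v G⁻¹ G) k
    rw [Matrix.nonsing_inv_mul _ hGu, Matrix.one_mulVec] at this
    exact this
  have e4 : ∀ y : Coord n, y ≠ 0 → ∀ k, ((n : ℝ) + 2) * Z k y
      = 2 * (y k * D y) - q y * ∑ b, G⁻¹ k b * pd b D y := by
    intro y hy k
    rw [← inv_lower (fun a => Z a y) k, Finset.mul_sum]
    have h1 : ∀ b, ((n : ℝ) + 2) * (G⁻¹ k b * ∑ a, G b a * Z a y)
        = 2 * D y * (G⁻¹ k b * yl b y) - q y * (G⁻¹ k b * pd b D y) := fun b => by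
      linear_combination G⁻¹ k b * e3 y hy b
    rw [Finset.sum_congr rfl fun b _ => h1 b, Finset.sum_sub_distrib, ← Finset.mul_sum,
      ← Finset.mul_sum, inv_lower (fun a => y a) k]
    ring
  -- Divergence of `e4`. Its left side gives back `(n+2) D`, because `D` is the divergence of `Z`.
  have pde : ∀ y : Coord n, y ≠ 0 →
      q y * ∑ a, ∑ b, G⁻¹ a b * pd a (pd b D) y = (n - 2) * D y := by
    intro y hy
    have hS : ∀ k, DifferentiableAt ℝ (fun y => ∑ b, G⁻¹ k b * pd b D y) y := fun k =>
      DifferentiableAt.fun_sum fun b _ => (ddD b y hy).const_mul _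
    have h1 : ∀ k, ((n : ℝ) + 2) * J k k y
        = 2 * (y k * pd k D y) + 2 * D y - 2 * (yl k y * ∑ b, G⁻¹ k b * pd b D y)
          - q y * ∑ b, G⁻¹ k b * pd k (pd b D) y := by
      intro k
      have h := pd_congr_of_eqOn k isOpen_slit (fun z hz => e4 z hz k) hy
      have hyD := (differentiableAt_coord k).fun_mul (dD y hy)
      rw [pd_const_mul _ _ (dZ k y hy), pZ k k y hy,
        pd_sub _ (hyD.const_mul _) ((dq y).fun_mul (hS k)), pd_const_mul _ _ hyD,
        pd_mul _ (differentiableAt_coord k) (dD y hy), pd_mul _ (dq y) (hS k), pq, pd_coord,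
        if_pos rfl, pd_sum _ _ fun b _ => (ddD b y hy).const_mul _,
        Finset.sum_congr rfl fun b _ => pd_const_mul k (G⁻¹ k b) (ddD b y hy)] at h
      linear_combination h
    have h2 : ∑ k, yl k y * ∑ b, G⁻¹ k b * pd b D y = D y := by
      rw [← eD y hy]
      have h3 : ∑ k, yl k y * ∑ b, G⁻¹ k b * pd b D y
          = ∑ a, y a * ∑ k, G a k * ∑ b, G⁻¹ k b * pd b D y := by
        simp only [hyl, Finset.sum_mul]
        rw [Finset.sum_comm]
        refine Finset.sum_congr rfl fun a _ => ?_
        rw [Finset.mul_sum]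
        exact Finset.sum_congr rfl fun k _ => by rw [hGs a k]; ring
      rw [h3]
      refine Finset.sum_congr rfl fun a _ => ?_
      have := congrFun (Matrix.mulVec_mulVec (fun b => pd b D y) G G⁻¹) a
      rw [Matrix.mul_nonsing_inv _ hGu, Matrix.one_mulVec] at this
      exact congrArg (y a * ·) this
    have h4 := Finset.sum_congr rfl fun k (_ : k ∈ Finset.univ) => h1 k
    rw [← Finset.mul_sum, Finset.sum_sub_distrib, Finset.sum_sub_distrib, Finset.sum_add_distrib,
      ← Finset.mul_sum, ← Finset.mul_sum, ← Finset.mul_sum, h2, eD y hy, Finset.sum_const,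
      Finset.card_univ, Fintype.card_fin, nsmul_eq_mul] at h4
    change ((n : ℝ) + 2) * D y = _ at h4
    rw [Finset.mul_sum]
    linear_combination h4
  have hD0 : ∀ y ∈ ({0}ᶜ : Set (Coord n)), D y = 0 := fun y hy =>
    eq_zero_of_metric_laplace_eq hn hG sD homD pde hy
  have hZ0 : ∀ y ∈ ({0}ᶜ : Set (Coord n)), Z k y = 0 := by
    intro y hy
    have h := e4 y hy k
    have hpD : ∀ b, pd b D y = 0 := fun b =>
      (pd_congr_of_eqOn b isOpen_slit hD0 hy).trans (pd_const b 0)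
    simpa [hD0 y hy, hpD, hn2] using h
  rw [← pZ i k y hy]
  exact (pd_congr_of_eqOn i isOpen_slit hZ0 hy).trans (pd_const i 0)

/-- A covector `A` with `A_i y^j = (A_b y^b) δ_i^j` and `y ≠ 0` vanishes in dimension at least
two. -/
lemma covector_eq_zero (hn : 2 ≤ n) {A : Fin n → ℝ} {y : Coord n} (hy : y ≠ 0)
    (h : ∀ i j, ∑ b, A b * ((if i = b then 1 else 0) * y j - y b * (if i = j then 1 else 0)) = 0)
    (i : Fin n) : A i = 0 := by
  have h1 : ∀ i j, A i * y j - (∑ b, A b * y b) * (if i = j then 1 else 0) = 0 := by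
    intro i j
    refine Eq.trans ?_ (h i j)
    simp only [mul_sub, Finset.sum_sub_distrib, Finset.sum_mul, mul_assoc]
    simp
  -- The trace over `i = j` gives `(1 - n) A_b y^b = 0`.
  have h2 : ∑ b, A b * y b = 0 := by
    have h3 := Finset.sum_congr rfl fun i (_ : i ∈ Finset.univ) => h1 i i
    simp only [if_true, mul_one, Finset.sum_sub_distrib, Finset.sum_const, Finset.card_univ,
      Fintype.card_fin, nsmul_eq_mul, mul_zero] at h3
    have hn' : (2 : ℝ) ≤ n := by exact_mod_cast hn
    have h4 : (∑ b, A b * y b) * (1 - (n : ℝ)) = 0 := by linear_combination h3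
    exact (mul_eq_zero.mp h4).resolve_right (by linarith)
  obtain ⟨j, hj⟩ : ∃ j, y j ≠ 0 := by
    by_contra! hc
    exact hy (by ext j; exact hc j)
  have h5 := h1 i j
  rw [h2, zero_mul, sub_zero] at h5
  exact (mul_eq_zero.mp h5).resolve_right hj

variable {M : Type*} [TopologicalSpace M] [ChartedSpace (Coord n) M] [IsManifold (𝓡 n) ∞ M]
  {L : TangentBundle (𝓡 n) M → ℝ}

lemma eq_metricConnection_of_mem_symSol (hn : 3 ≤ n) (hL : IsRiemannian L)
    {N : CoeffFamily n M} (hN : N ∈ symSol L) : N = metricConnection L := by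
  obtain ⟨hN, haff, hsymm⟩ := hN
  have hn0 : 0 < n := by omega
  have hM := isNonlinearConnection_metricConnection hL hn0
  funext e x y i k
  by_cases hxy : (x, y) ∈ slitDomain e
  swap
  -- Off the coordinate domain both families are zero by convention.
  · rw [hN.off_domain e x y hxy, hM.off_domain e x y hxy]
  have hx : x ∈ e.1.target := hxy.1
  have sN : ∀ i k, ContDiffOn ℝ ∞ (fun y => N e x y i k) {0}ᶜ := fun i k =>
    contDiffOn_vertical e (f := fun x y => N e x y i k) (hN.smooth e i k) hx
  have sM : ∀ i k, ContDiffOn ℝ ∞ (fun y => metricConnection L e x y i k) {0}ᶜ := fun i k =>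
    contDiffOn_vertical e (f := fun x y => metricConnection L e x y i k) (hM.smooth e i k) hx
  have symm : ∀ y : Coord n, y ≠ 0 → ∀ i j k,
      pd j (diffTensor L N e i k x) y = pd i (diffTensor L N e j k x) y := by
    intro y hy i j k
    have h1 := hsymm e x y ⟨hx, hy⟩ i j k
    have h2 := isSymmetric_metricConnection hL hn0 e x y ⟨hx, hy⟩ i j k
    have hs : ∀ a b, pd a (diffTensor L N e b k x) y
        = dy a (fun x y => N e x y b k) x y
          - dy a (fun x y => metricConnection L e x y b k) x y := fun a b =>
      pd_sub a (differentiableAt_of_contDiffOn isOpen_slit (sN b k) hy)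
        (differentiableAt_of_contDiffOn isOpen_slit (sM b k) hy)
    rw [hs, hs]
    linarith
  refine sub_eq_zero.mp (eq_zero_of_symmetric_of_trace_eq (J := fun i k => diffTensor L N e i k x)
    hn ((isLocalMetric_metricMatrix hL hn0 e).posDef x hx) (fun i k => (sN i k).sub (sM i k))
    (fun i k y hy t ht => ?_) symm (fun y hy b => ?_) hxy.2 i k)
  · simp only [diffTensor, hN.homogeneous e x y ⟨hx, hy⟩ t ht i k,
      hM.homogeneous e x y ⟨hx, hy⟩ t ht i k]
    ring
  -- Symmetry of `J` removes the last term of the affine equation, so only the algebraic condition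
  -- on the covector remains.
  · have hA : affineCovector L N e b x y = 0 := by
      refine covector_eq_zero (A := fun b => affineCovector L N e b x y) (by omega) hy
        (fun i j => ?_) b
      have h := haff e x y ⟨hx, hy⟩ i j
      have h0 : ∑ a, (dy a (diffTensor L N e i j) x y - dy i (diffTensor L N e a j) x y) * y a
          = 0 := Finset.sum_eq_zero fun a _ => by
        rw [show dy a (diffTensor L N e i j) x y = dy i (diffTensor L N e a j) x y from
          symm y hy i a j, sub_self, zero_mul]
      rw [h0, sub_zero] at h
      exact h
    -- By symmetry the two divergence terms of the covector coincide, whence the factor `2` in the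
    -- trace equation.
    have hs : ∀ a, dy a (diffTensor L N e b a) x y = dy b (diffTensor L N e a a) x y := fun a =>
      symm y hy b a a
    simp only [affineCovector, meanLandsberg_eq_zero hL hn0 e hx hy,
      meanCartan_eq_zero hL hn0 e hx hy, lowerY, fundTensor_eq_metricMatrix hL hn0 e hx hy,
      localL_eq_quadratic hL hn0 e hx hy, hs, Finset.sum_add_distrib, zero_mul,
      Finset.sum_const_zero, mul_zero] at hA
    change _ = 2 * ∑ a, dy b (diffTensor L N e a a) x y
    linarith

end Uniqueness
end FinslerPalatini

end

theorem mainTheorem9 (n : ℕ) (hn : 3 ≤ n) (M : Type*) [TopologicalSpace M]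
    [ChartedSpace (EuclideanSpace ℝ (Fin n)) M] [IsManifold (𝓡 n) ∞ M]
    (L : TangentBundle (𝓡 n) M → ℝ) (hL : FinslerPalatini.IsRiemannian L) :
    FinslerPalatini.symSol L = {FinslerPalatini.metricConnection L} := by
  have hn0 : 0 < n := by omega
  refine Set.Subset.antisymm
    (fun N hN => FinslerPalatini.eq_metricConnection_of_mem_symSol hn hL hN) ?_
  rintro N rfl
  exact ⟨FinslerPalatini.isNonlinearConnection_metricConnection hL hn0,
    FinslerPalatini.solvesAffineEquation_metricConnection hL hn0,
    FinslerPalatini.isSymmetric_metricConnection hL hn0⟩
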